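/- Let $(R,\mathfrak m)$ be a commutative Noetherian local ring and let $I$ be an $\mathfrak m$-primary ideal. All modules are finitely generated, $\ell_R$ denotes length, and for a nonzero $R$-module $X$ of dimension $d$ $$e_R(I,X)=d!\,\lim_{n\to\infty}\frac{\ell_R(X/I^nX)}{n^d},\qquad e_R(I,0)=0 .$$ Put $\operatorname{Assh}_R(X)=\{\mathfrak p\in\operatorname{Ass}_R(X):\dim(R/\mathfrak p)=\dim_R X\}$ and call $X$ *unmixed* if $\operatorname{Ass}_R(X)=\operatorname{Assh}_R(X)$. For $Y\subseteq\operatorname{Spec}R$, $X$ is *free on* $Y$ if $X_{\mathfrak p}$ is a free $R_{\mathfrak p}$-module for all $\mathfrak p\in Y$, and $X$ *has rank* $r\in\mathbb N=\{0,1,2,\dots\}$ if $X_{\mathfrak p}\cong R_{\mathfrak p}^{\oplus r}$ for all $\mathfrak p\in\operatorname{Ass}(R)$. A module is *torsion* if each of its elements is killed by a nonzerodivisor of $R$. **Theorem.** Let $M\neq 0$ and $N$ be $R$-modules such that $M/IM$ and $N/IN$ are both free over $R/I$, $\dim_R(M)=\dim_R(M\otimes_RN)$, and $M\otimes_RN$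 is Cohen–Macaulay. Let $c$ be a real number with $e_R(I,M)\le c\cdot\ell_R(M/IM)$. Then $N$ is free over $R$ if at least one of the following holds: - (i) $N$ has rank, $\operatorname{Tor}_1^R(M,N)_{\mathfrak p}=0$ for some $\mathfrak p\in\operatorname{Assh}_R(M)$, and $c<1+\dfrac1{e_R(I,M\otimes_RN)}$. - (ii) $N$ is free on $\operatorname{Assh}_R(M)$, $N$ has rank $r$ (which must then be positive), and $c<1+\dfrac1r$. - (iii) $M$ is unmixed, $c<1+\dfrac1{e_R(I,M\otimes_RN)}$, and at least one of the following holds: (a) $M$ is faithful; (b) $\operatorname{Tor}_1^R(M,N)=0$; (c) $\operatorname{Tor}_1^R(M,N)$ is torsion and $\operatorname{Supp}_R(M)=\operatorname{Spec}(R)$. - (iv) $M$ has positive rank, $R$ is unmixed, and $c<1+\dfrac1{e_R(I,N)}$. - (v) $M$ has positive rank, $R$ is unmixed, $e_R(I,N)=r\cdot e_R(I,R)$ for some $r\in\mathbb N$, and $c<1+\dfrac1r$. -/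

import Mathlib

open scoped TensorProduct

universe u v

namespace CUlrich

open IsLocalRing

/-- The quotient `M / I M`, as a module over `R` and over `R / I`. -/
abbrev QuotIdeal {R : Type u} [CommRing R] (I : Ideal R) (M : Type v) [AddCommGroup M]
    [Module R M] : Type v :=
  M ⧸ (I • (⊤ : Submodule R M))

/-- The length `ℓ_R(M)` as a real number (used only for modules of finite length). -/
noncomputable def lengthReal (R : Type u) [CommRing R] (M : Type v) [AddCommGroup M]
    [Module R M] : ℝ :=
  ((Module.length R M).toNat : ℝ)

/-- The dimension of a nonzero finitely generated module over a Noetherian local ring,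
as a natural number. -/
noncomputable def dimNat (R : Type u) [CommRing R] (M : Type v) [AddCommGroup M]
    [Module R M] : ℕ :=
  ((Module.supportDim R M).unbotD 0).toNat

open Classical in
/-- The Hilbert-Samuel multiplicity `e_R(I, M) = d! * lim_n ℓ_R(M / I ^ n M) / n ^ d`, where
`d = dim_R M`, for `M ≠ 0`; and `e_R(I, 0) = 0`. -/
noncomputable def hilbertSamuelMult {R : Type u} [CommRing R] (I : Ideal R) (M : Type v)
    [AddCommGroup M] [Module R M] : ℝ :=
  if Subsingleton M then 0
  else ((dimNat R M).factorial : ℝ) *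
    Filter.limUnder Filter.atTop
      (fun n : ℕ => lengthReal R (QuotIdeal (I ^ n) M) / (n : ℝ) ^ dimNat R M)

/-- The depth of a module over a local ring: the supremum of the lengths of the `M`-regular
sequences in the maximal ideal. -/
noncomputable def depth (R : Type u) [CommRing R] [IsLocalRing R] (M : Type v)
    [AddCommGroup M] [Module R M] : ℕ∞ :=
  ⨆ (rs : List R) (_ : (∀ r ∈ rs, r ∈ maximalIdeal R) ∧ RingTheory.Sequence.IsRegular M rs),
    (rs.length : ℕ∞)

/-- A finitely generated module `M` over a Noetherian local ring is Cohen-Macaulay if it is zero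
or its depth equals its dimension. -/
def IsCohenMacaulay (R : Type u) [CommRing R] [IsLocalRing R] (M : Type v)
    [AddCommGroup M] [Module R M] : Prop :=
  Subsingleton M ∨ ((depth R M : ℕ∞) : WithBot ℕ∞) = Module.supportDim R M

/-- `Ass_R(M)` as a set of points of `Spec R`. -/
def Ass (R : Type u) [CommRing R] (M : Type v) [AddCommGroup M] [Module R M] :
    Set (PrimeSpectrum R) :=
  {p | p.asIdeal ∈ associatedPrimes R M}

/-- `Assh_R(M) = {p ∈ Ass_R(M) : dim (R / p) = dim_R M}`. -/
def Assh (R : Type u) [CommRing R] (M : Type v) [AddCommGroup M] [Module R M] :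
    Set (PrimeSpectrum R) :=
  {p | p ∈ Ass R M ∧ ringKrullDim (R ⧸ p.asIdeal) = Module.supportDim R M}

/-- `M` is unmixed: `Ass_R(M) = Assh_R(M)`. -/
def IsUnmixed (R : Type u) [CommRing R] (M : Type v) [AddCommGroup M] [Module R M] : Prop :=
  Ass R M = Assh R M

/-- `M` is free on `Y`: the localization `M_p` is a free `R_p`-module for all `p ∈ Y`. -/
def FreeOn (R : Type u) [CommRing R] (M : Type v) [AddCommGroup M] [Module R M]
    (Y : Set (PrimeSpectrum R)) : Prop :=
  ∀ p ∈ Y, Module.Free (Localization.AtPrime p.asIdeal) (LocalizedModule.AtPrime p.asIdeal M)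

/-- `M` has rank `r` on `Y`: `M_p ≅ R_p ^ r` for all `p ∈ Y`. -/
def HasRankOn (R : Type u) [CommRing R] (M : Type v) [AddCommGroup M] [Module R M]
    (Y : Set (PrimeSpectrum R)) (r : ℕ) : Prop :=
  ∀ p ∈ Y, Nonempty (LocalizedModule.AtPrime p.asIdeal M
    ≃ₗ[Localization.AtPrime p.asIdeal] (Fin r → Localization.AtPrime p.asIdeal))

/-- `M` has rank `r`: it has rank `r` on `Ass(R)`. -/
def HasRank (R : Type u) [CommRing R] (M : Type v) [AddCommGroup M] [Module R M]
    (r : ℕ) : Prop :=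
  HasRankOn R M (Ass R R) r

/-- `Tor_1^R(M, N)`. -/
noncomputable abbrev Tor1 (R : Type u) [CommRing R] (M N : Type u) [AddCommGroup M] [Module R M]
    [AddCommGroup N] [Module R N] : ModuleCat.{u} R :=
  ((CategoryTheory.Tor (ModuleCat.{u} R) 1).obj (ModuleCat.of R M)).obj (ModuleCat.of R N)

end CUlrich

/-!
Let `T = M ⊗ N` and `d = dim M = dim T`. Since `N / I N` is free of some rank `n` over `R / I`,
there is a presentation `0 → K → R ^ n → N → 0` for which `ℓ(T / I T) = n ℓ(M / I M)`
(`exists_presentation`, `hsFun_tensorProduct_one`), and `N` is free as soon as `K = 0`; for this it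
is enough that `K` vanishes at the associated primes of `R`
(`subsingleton_of_forall_notMem_support`). For the Cohen-Macaulay module `T` one has
`ℓ(T / I T) ≤ e(T)` (`len_le_mult_of_isCohenMacaulay`), so the bound on `c` gives
`n e(M) ≤ c e(T)`.

Let `L = ker (M ^ n → T)`. In cases (i) and (iii), `e(L) = n e(M) - e(T) ≤ (c - 1) e(T) < 1`, so
that `e(L) = 0` and `L` vanishes at the primes of dimension `d`. As `Tor₁(M, N)` maps onto the
kernel of `M ⊗ K → M ^ n` (`exists_surjective_Tor1`), `K` vanishes wherever `L` and `Tor₁` do and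
`M` does not; and if `L = 0`, the coordinates of the elements of `K` kill `M`. In case (iv) the
same estimate applies to `K` in place of `L`. In cases (ii) and (v), `e(T) = r e(M)` by the
associativity formula (`mult_tensorProduct`), whence `n ≤ r`: then `R_q ^ n → N_q` is bijective
where `N_q` is free of rank `r`, respectively `e(K) = (n - r) e(R) ≤ 0`.

The theory of multiplicities is developed from iterated differences. The Hilbert-Samuel function is
eventually polynomial: over an infinite residue field, superficial elements
(`exists_superficial`) allow Noetherian induction, and the general case follows by passing to the
localization `R(X)` of `R[X]` (`exists_flat_infinite_residueField`). A prime filtration bounds its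
degree by the dimension (`exists_hsFun_le`), so for `dim X ≤ d` its `d`-th difference is eventually
a constant `mult I d X`, additive in short exact sequences by the Artin-Rees lemma and positive
exactly when `dim X = d`. Fixing `d` in the notation makes additivity hold without case
distinctions on the dimensions of the three modules.
-/

/-! ### Integer sequences that are eventually polynomial -/

open Filter Topology in
theorem tendsto_choose_div_pow (k d : ℕ) (hk : k ≤ d) :
    Tendsto (fun n : ℕ => (n.choose k : ℝ) / (n : ℝ) ^ d) atTop
      (𝓝 (if k = d then 1 / (d.factorial : ℝ) else 0)) := by
  have h1 : Tendsto (fun n : ℕ => (n.choose k : ℝ) / (n : ℝ) ^ k) atTop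
      (𝓝 (1 / (k.factorial : ℝ))) := by
    have h := isEquivalent_choose k
    have h2 := (h.div (Asymptotics.IsEquivalent.refl (u := fun n : ℕ => (n : ℝ) ^ k)))
    have h3 : Tendsto (fun n : ℕ => ((n : ℝ) ^ k / k.factorial) / (n : ℝ) ^ k) atTop
        (𝓝 (1 / (k.factorial : ℝ))) := by
      refine tendsto_const_nhds.congr' ?_
      filter_upwards [eventually_gt_atTop 0] with n hn
      have : (n : ℝ) ^ k ≠ 0 := by positivity
      field_simp
    exact h2.symm.tendsto_nhds h3
  split_ifs with h
  · subst h; exact h1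
  · obtain ⟨j, rfl⟩ : ∃ j, d = k + (j + 1) := ⟨d - k - 1, by omega⟩
    have h2 : Tendsto (fun n : ℕ => 1 / (n : ℝ) ^ (j + 1)) atTop (𝓝 0) := by
      have := tendsto_inv_atTop_zero.comp
        ((tendsto_pow_atTop (α := ℝ) (n := j + 1) (by omega)).comp tendsto_natCast_atTop_atTop)
      simpa [Function.comp_def] using this
    have h3 := h1.mul h2
    rw [mul_zero] at h3
    refine h3.congr fun n => ?_
    rw [div_mul_div_comm, mul_one, ← pow_add]

open Filter Topology in
theorem tendsto_shift_div_pow (m d : ℕ) :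
    Tendsto (fun n : ℕ => (n : ℝ) ^ d / ((n + m : ℕ) : ℝ) ^ d) atTop (𝓝 1) := by
  have h := (tendsto_natCast_div_add_atTop (𝕜 := ℝ) (m : ℝ)).pow d
  rw [one_pow] at h
  refine h.congr fun n => ?_
  push_cast
  rw [div_pow]

open Filter Topology in
/-- A sequence whose `d`-th difference is eventually equal to `e` grows like `e * n ^ d / d!`. -/
theorem tendsto_div_pow_of_fwdDiff_iter_eq {h : ℕ → ℤ} {d : ℕ} {e : ℤ}
    (H : ∀ᶠ n in atTop, (fwdDiff 1)^[d] h n = e) :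
    Tendsto (fun n : ℕ => (h n : ℝ) / (n : ℝ) ^ d) atTop (𝓝 ((e : ℝ) / d.factorial)) := by
  obtain ⟨n₀, hn₀⟩ := eventually_atTop.1 H
  have hz : ∀ j, ∀ n ≥ n₀, (fwdDiff 1)^[d + 1 + j] h n = 0 := by
    intro j
    induction j with
    | zero =>
      intro n hn
      rw [add_zero, Function.iterate_succ_apply', fwdDiff, hn₀ _ hn, hn₀ _ (by omega), sub_self]
    | succ j ih =>
      intro n hn
      rw [← add_assoc, Function.iterate_succ_apply', fwdDiff, ih _ hn, ih _ (by omega), sub_self]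
  have newton : ∀ n ≥ d, h (n + n₀) =
      ∑ k ∈ Finset.range (d + 1), (n.choose k : ℤ) * (fwdDiff 1)^[k] h n₀ := by
    intro n hn
    have := shift_eq_sum_fwdDiff_iter 1 h n n₀
    rw [add_comm, show n₀ + n = n₀ + n • 1 by simp, this]
    symm
    simp only [nsmul_eq_mul]
    refine Finset.sum_subset (Finset.range_mono (by omega)) ?_
    intro k _ hk
    simp only [Finset.mem_range, not_lt] at hk
    obtain ⟨j, rfl⟩ := Nat.exists_eq_add_of_le hk
    rw [hz j n₀ le_rfl, mul_zero]
  have h1 : Tendsto (fun n : ℕ => ∑ k ∈ Finset.range (d + 1),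
      ((n.choose k : ℝ) / (n : ℝ) ^ d) * ((fwdDiff 1)^[k] h n₀ : ℤ)) atTop
      (𝓝 (∑ k ∈ Finset.range (d + 1), (if k = d then 1 / (d.factorial : ℝ) else 0) *
        ((fwdDiff 1)^[k] h n₀ : ℤ))) :=
    tendsto_finsetSum _ fun k hk =>
      (tendsto_choose_div_pow k d (by simpa [Nat.lt_succ_iff] using hk)).mul_const _
  have h2 : (∑ k ∈ Finset.range (d + 1), (if k = d then 1 / (d.factorial : ℝ) else 0) *
        ((fwdDiff 1)^[k] h n₀ : ℤ)) = (e : ℝ) / d.factorial := by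
    rw [Finset.sum_eq_single d]
    · rw [if_pos rfl, hn₀ _ le_rfl]; ring
    · intro k _ hk; rw [if_neg hk, zero_mul]
    · simp
  rw [h2] at h1
  have h3 := h1.mul (tendsto_shift_div_pow n₀ d)
  rw [mul_one] at h3
  rw [← tendsto_add_atTop_iff_nat n₀]
  refine h3.congr' ?_
  filter_upwards [eventually_ge_atTop d, eventually_gt_atTop 0] with n hn hn0
  rw [newton n hn]
  have : (n : ℝ) ^ d ≠ 0 := by positivity
  push_cast
  rw [Finset.sum_mul, Finset.sum_div]
  refine Finset.sum_congr rfl fun k _ => ?_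
  field_simp

open Filter in
theorem fwdDiff_iter_congr {f g : ℕ → ℤ} (h : f =ᶠ[atTop] g) (j : ℕ) :
    (fwdDiff 1)^[j] f =ᶠ[atTop] (fwdDiff 1)^[j] g := by
  induction j generalizing f g with
  | zero => exact h
  | succ j ih =>
    rw [Function.iterate_succ_apply, Function.iterate_succ_apply]
    refine ih ?_
    filter_upwards [h, (tendsto_add_atTop_nat 1).eventually h] with n h1 h2
    rw [fwdDiff, fwdDiff, h1, h2]

theorem fwdDiff_iter_zero (j : ℕ) : (fwdDiff 1)^[j] (fun _ : ℕ => (0 : ℤ)) = fun _ => 0 := by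
  induction j with
  | zero => rfl
  | succ j ih => rw [Function.iterate_succ_apply, fwdDiff_const, ih]

open Filter in
/-- A sequence is eventually polynomial if some iterated difference of it eventually vanishes. -/
def EventuallyPolynomial (h : ℕ → ℤ) : Prop :=
  ∃ D : ℕ, ∀ᶠ n in atTop, (fwdDiff 1)^[D] h n = 0

open Filter in
theorem EventuallyPolynomial.congr {f g : ℕ → ℤ} (hf : EventuallyPolynomial f)
    (h : f =ᶠ[atTop] g) : EventuallyPolynomial g := by
  obtain ⟨D, hD⟩ := hf
  refine ⟨D, ?_⟩
  filter_upwards [hD, fwdDiff_iter_congr h D] with n h1 h2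
  rw [← h2, h1]

theorem eventuallyPolynomial_const (c : ℤ) : EventuallyPolynomial fun _ => c :=
  ⟨1, Filter.Eventually.of_forall fun n => by simp⟩

open Filter in
/-- A sequence whose difference agrees eventually with a shift of an eventually polynomial
sequence, up to a constant, is eventually polynomial. -/
theorem EventuallyPolynomial.of_fwdDiff {f g : ℕ → ℤ} (hg : EventuallyPolynomial g) (c : ℤ)
    (h : ∀ᶠ n in atTop, f (n + 1) - f n = g (n + 1) - c) : EventuallyPolynomial f := by
  obtain ⟨D, hD⟩ := hg
  refine ⟨D + 2, ?_⟩
  have h1 : fwdDiff 1 (fwdDiff 1 f) =ᶠ[atTop] fwdDiff 1 (fun n => g (n + 1)) := by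
    filter_upwards [h, (tendsto_add_atTop_nat 1).eventually h] with n h1 h2
    simp only [fwdDiff]
    rw [h1, h2]; ring
  have h2 := fwdDiff_iter_congr h1 D
  rw [← Function.iterate_succ_apply, ← Function.iterate_succ_apply,
    ← Function.iterate_succ_apply, Function.iterate_succ_apply' _ D] at h2
  have h3 : ∀ᶠ n in atTop, (fwdDiff 1)^[D] (fun n => g (n + 1)) n = 0 := by
    filter_upwards [(tendsto_add_atTop_nat 1).eventually hD] with n hn
    rw [fwdDiff_iter_comp_add]; exact hn
  filter_upwards [h2, h3, (tendsto_add_atTop_nat 1).eventually h3] with n a b c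
  rw [a, fwdDiff, b, c, sub_self]

open Filter in
theorem exists_eventually_fwdDiff_iter_eq {h : ℕ → ℤ} {d : ℕ}
    (H : ∀ᶠ n in atTop, (fwdDiff 1)^[d + 1] h n = 0) :
    ∃ e : ℤ, ∀ᶠ n in atTop, (fwdDiff 1)^[d] h n = e := by
  obtain ⟨n₀, hn₀⟩ := eventually_atTop.1 H
  refine ⟨(fwdDiff 1)^[d] h n₀, eventually_atTop.2 ⟨n₀, fun n hn => ?_⟩⟩
  induction n, hn using Nat.le_induction with
  | base => rfl
  | succ n hn ih =>
    have := hn₀ n hn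
    rw [Function.iterate_succ_apply', fwdDiff, sub_eq_zero] at this
    rw [this, ih]

open Filter Topology in
/-- An eventually polynomial sequence bounded by a constant times `n ^ d` has degree at most `d`. -/
theorem exists_fwdDiff_iter_eq_of_le {h : ℕ → ℤ} {D d : ℕ}
    (H : ∀ᶠ n in atTop, (fwdDiff 1)^[D] h n = 0) (hpos : ∀ n, 0 ≤ h n) {C : ℝ}
    (hC : ∀ n, (h n : ℝ) ≤ C * ((n : ℝ) + 1) ^ d) :
    ∃ e : ℤ, ∀ᶠ n in atTop, (fwdDiff 1)^[d] h n = e := by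
  rcases le_or_gt D d with hD | hD
  · obtain ⟨j, rfl⟩ := Nat.exists_eq_add_of_le hD
    refine ⟨0, ?_⟩
    have := fwdDiff_iter_congr (g := fun _ => 0) H j
    rwa [fwdDiff_iter_zero, ← Function.iterate_add_apply, add_comm j D] at this
  obtain ⟨k, rfl⟩ := Nat.exists_eq_add_of_lt hD
  clear hD
  induction k with
  | zero => exact exists_eventually_fwdDiff_iter_eq H
  | succ k ih =>
    refine ih ?_
    obtain ⟨c, hc⟩ := exists_eventually_fwdDiff_iter_eq (d := d + k + 1) H
    have lim := tendsto_div_pow_of_fwdDiff_iter_eq hc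
    -- the bound forces the coefficient of `n ^ (d + k + 1)` to vanish
    have lim0 : Tendsto (fun n : ℕ => (h n : ℝ) / (n : ℝ) ^ (d + k + 1)) atTop (𝓝 0) := by
      have b : Tendsto (fun n : ℕ => C * (((n : ℝ) + 1) ^ d / (n : ℝ) ^ (d + k + 1))) atTop
          (𝓝 0) := by
        have h1 : Tendsto (fun n : ℕ => (((n : ℝ) + 1) ^ d / (n : ℝ) ^ d)) atTop (𝓝 1) := by
          have := (tendsto_shift_div_pow 1 d).inv₀ one_ne_zero
          rw [inv_one] at this
          refine this.congr fun n => ?_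
          rw [inv_div]; push_cast; rfl
        have h2 : Tendsto (fun n : ℕ => 1 / (n : ℝ) ^ (k + 1)) atTop (𝓝 0) := by
          have := tendsto_inv_atTop_zero.comp
            ((tendsto_pow_atTop (α := ℝ) (n := k + 1) (by omega)).comp tendsto_natCast_atTop_atTop)
          simpa [Function.comp_def] using this
        have h3 := (h1.mul h2).const_mul C
        simp only [mul_zero] at h3
        refine h3.congr fun n => ?_
        rw [div_mul_div_comm, mul_one, ← pow_add, ← add_assoc]
      refine squeeze_zero (fun n => ?_) (fun n => ?_) b
      · have := hpos n
        positivity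
      · rw [← mul_div_assoc]
        exact div_le_div_of_nonneg_right (hC n) (by positivity)
    have hc0 : c = 0 := by
      have := tendsto_nhds_unique lim lim0
      have hf : ((d + k + 1).factorial : ℝ) ≠ 0 := by positivity
      rw [div_eq_zero_iff] at this
      exact_mod_cast this.resolve_right hf
    rw [hc0] at hc
    exact hc

/-! ### Lengths and the Hilbert-Samuel function -/

namespace CUlrich

open IsLocalRing Filter

section Length

variable {R : Type u} [CommRing R]

/-- The length of a module as an integer; it is `0` for modules of infinite length. -/
noncomputable def len (R : Type u) [CommRing R] (X : Type v) [AddCommGroup X] [Module R X] : ℤ :=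
  ((Module.length R X).toNat : ℤ)

theorem len_nonneg (X : Type v) [AddCommGroup X] [Module R X] : 0 ≤ len R X :=
  Int.natCast_nonneg _

theorem len_congr {X Y : Type*} [AddCommGroup X] [Module R X] [AddCommGroup Y]
    [Module R Y] (e : X ≃ₗ[R] Y) : len R X = len R Y := by
  rw [len, len, e.length_eq]

theorem lengthReal_eq (X : Type v) [AddCommGroup X] [Module R X] :
    lengthReal R X = (len R X : ℝ) := by
  simp [lengthReal, len]

theorem len_of_exact {X Y Z : Type*} [AddCommGroup X] [Module R X] [AddCommGroup Y]
    [Module R Y] [AddCommGroup Z] [Module R Z] (hY : IsFiniteLength R Y)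
    (f : X →ₗ[R] Y) (g : Y →ₗ[R] Z) (hf : Function.Injective f) (hg : Function.Surjective g)
    (H : Function.Exact f g) : len R Y = len R X + len R Z := by
  have h := Module.length_eq_add_of_exact f g hf hg H
  have h1 : Module.length R X ≠ ⊤ := Module.length_ne_top_iff.2 (hY.of_injective hf)
  have h2 : Module.length R Z ≠ ⊤ := Module.length_ne_top_iff.2 (hY.of_surjective hg)
  rw [len, len, len, h, ENat.toNat_add h1 h2]
  push_cast
  rfl

theorem len_le_of_surjective {X Y : Type*} [AddCommGroup X] [Module R X] [AddCommGroup Y]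
    [Module R Y] (hX : IsFiniteLength R X) (g : X →ₗ[R] Y) (hg : Function.Surjective g) :
    len R Y ≤ len R X := by
  have := Module.length_le_of_surjective g hg
  have h1 := Module.length_ne_top_iff.2 hX
  exact Int.ofNat_le.2 (ENat.toNat_le_toNat this h1)

theorem len_pos {X : Type*} [AddCommGroup X] [Module R X] [Nontrivial X]
    (hX : IsFiniteLength R X) : 0 < len R X := by
  have h1 := Module.length_ne_top_iff.2 hX
  have h2 : Module.length R X ≠ 0 := (Module.length_pos (R := R) (M := X)).ne'
  have : (Module.length R X).toNat ≠ 0 := by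
    rw [ne_eq, ENat.toNat_eq_zero]; tauto
  rw [len]; omega

/-- For a linear map `f : Y → X` and a submodule `J` of `X`, the exact sequence
`0 → Y / f⁻¹ J → X / J → X / (J + f Y) → 0` of lengths. -/
theorem len_quotient_eq {X Y : Type*} [AddCommGroup X] [Module R X] [AddCommGroup Y]
    [Module R Y] (f : Y →ₗ[R] X) (J : Submodule R X) (hJ : IsFiniteLength R (X ⧸ J)) :
    len R (X ⧸ J) = len R (Y ⧸ J.comap f) + len R (X ⧸ (J ⊔ LinearMap.range f)) := by
  refine len_of_exact hJ (Submodule.mapQ (J.comap f) J f le_rfl)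
    (Submodule.factor (le_sup_left : J ≤ J ⊔ LinearMap.range f)) ?_
    (Submodule.factor_surjective _) ?_
  · rw [← LinearMap.ker_eq_bot, Submodule.ker_mapQ, Submodule.mkQ_map_self]
  · rw [LinearMap.exact_iff, Submodule.range_mapQ]
    ext x
    obtain ⟨x, rfl⟩ := J.mkQ_surjective x
    have : Submodule.factor (le_sup_left : J ≤ J ⊔ LinearMap.range f) (J.mkQ x) =
      (J ⊔ LinearMap.range f).mkQ x := rfl
    rw [LinearMap.mem_ker, this, Submodule.mkQ_apply, Submodule.Quotient.mk_eq_zero,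
      Submodule.mem_sup, Submodule.mem_map]
    constructor
    · rintro ⟨a, ha, b, hb, rfl⟩
      refine ⟨b, hb, ?_⟩
      rw [map_add, show J.mkQ a = 0 from (Submodule.Quotient.mk_eq_zero J).2 ha, zero_add]
    · rintro ⟨b, hb, hbx⟩
      refine ⟨x - b, ?_, b, hb, by abel⟩
      rw [← Submodule.Quotient.mk_eq_zero J, Submodule.Quotient.mk_sub, sub_eq_zero]
      exact hbx.symm

theorem len_quotient_le {X : Type*} [AddCommGroup X] [Module R X] {J K : Submodule R X}
    (h : J ≤ K) (hJ : IsFiniteLength R (X ⧸ J)) : len R (X ⧸ K) ≤ len R (X ⧸ J) :=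
  len_le_of_surjective hJ (Submodule.factor h) (Submodule.factor_surjective _)

/-- The Hilbert-Samuel function `n ↦ ℓ(X / I ^ n X)`. -/
noncomputable def hsFun (I : Ideal R) (X : Type v) [AddCommGroup X] [Module R X] (n : ℕ) : ℤ :=
  len R (QuotIdeal (I ^ n) X)

theorem hsFun_nonneg (I : Ideal R) (X : Type v) [AddCommGroup X] [Module R X] (n : ℕ) :
    0 ≤ hsFun I X n := len_nonneg _

theorem hsFun_congr (I : Ideal R) {X Y : Type*} [AddCommGroup X] [Module R X] [AddCommGroup Y]
    [Module R Y] (e : X ≃ₗ[R] Y) (n : ℕ) : hsFun I X n = hsFun I Y n :=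
  len_congr (Submodule.Quotient.equiv _ _ e (by
    rw [Submodule.map_smul'', Submodule.map_top, LinearMap.range_eq_top.2 e.surjective]))

theorem smul_top_le_comap (J : Ideal R) {X Y : Type*} [AddCommGroup X] [Module R X]
    [AddCommGroup Y] [Module R Y] (f : Y →ₗ[R] X) :
    J • (⊤ : Submodule R Y) ≤ (J • (⊤ : Submodule R X)).comap f := by
  rw [← Submodule.map_le_iff_le_comap, Submodule.map_smul'']
  exact smul_mono_right _ le_top

/-- The Hilbert-Samuel function of a quotient `X / U`, computed inside `X`. -/
theorem hsFun_quotient (I : Ideal R) {X : Type v} [AddCommGroup X] [Module R X]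
    (U : Submodule R X) (n : ℕ) : hsFun I (X ⧸ U) n = len R (X ⧸ (I ^ n • ⊤ ⊔ U)) := by
  have e := Submodule.quotientQuotientEquivQuotient U (I ^ n • ⊤ ⊔ U) le_sup_right
  have : I ^ n • (⊤ : Submodule R (X ⧸ U)) = (I ^ n • ⊤ ⊔ U).map U.mkQ := by
    rw [Submodule.map_sup, Submodule.map_smul'', Submodule.map_top, Submodule.range_mkQ,
      Submodule.mkQ_map_self, sup_bot_eq]
  exact len_congr ((Submodule.quotEquivOfEq _ _ this).trans e)

/-- Artin-Rees: the filtration induced on `X` by an embedding `X → Y` is squeezed between two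
shifts of the `I`-adic filtration. -/
theorem exists_comap_smul_top_le [IsNoetherianRing R] (I : Ideal R) {X Y : Type*}
    [AddCommGroup X] [Module R X] [AddCommGroup Y]
    [Module R Y] [Module.Finite R Y] (f : X →ₗ[R] Y) (hf : Function.Injective f) :
    ∃ k : ℕ, ∀ n, (I ^ (n + k) • (⊤ : Submodule R Y)).comap f ≤ I ^ n • ⊤ := by
  obtain ⟨k, hk⟩ := I.exists_pow_inf_eq_pow_smul (LinearMap.range f)
  refine ⟨k, fun n x hx => ?_⟩
  have h1 : f x ∈ I ^ (n + k) • (⊤ : Submodule R Y) ⊓ LinearMap.range f := ⟨hx, x, rfl⟩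
  rw [hk (n + k) (by omega), Nat.add_sub_cancel] at h1
  have h2 : f x ∈ (I ^ n • (⊤ : Submodule R X)).map f := by
    rw [Submodule.map_smul'', Submodule.map_top]
    exact (smul_mono_right (I ^ n) (inf_le_right : (_ : Submodule R Y) ⊓ _ ≤ _)) h1
  obtain ⟨y, hy, hxy⟩ := h2
  rwa [hf hxy] at hy

end Length

section Finite

variable {R : Type u} [CommRing R] [IsLocalRing R] [IsNoetherianRing R]

theorem isFiniteLength_of_support_subset {X : Type v} [AddCommGroup X] [Module R X]
    [Module.Finite R X] (h : Module.support R X ⊆ {closedPoint R}) : IsFiniteLength R X := by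
  revert h
  induction ‹Module.Finite R X› using
    IsNoetherianRing.induction_on_isQuotientEquivQuotientPrime R with
  | subsingleton N => intro _; exact .of_subsingleton
  | quotient N p e =>
    intro h
    have hp : p = closedPoint R := by
      apply h
      rw [e.support_eq, Module.mem_support_iff_of_finite, Ideal.annihilator_quotient]
    have : IsSimpleModule R (R ⧸ p.1) := by
      rw [isSimpleModule_iff_quot_maximal]
      exact ⟨p.1, hp ▸ IsLocalRing.maximalIdeal.isMaximal R, ⟨LinearEquiv.refl _ _⟩⟩
    rw [← Module.length_ne_top_iff, e.length_eq, Module.length_eq_one]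
    exact ENat.one_ne_top
  | exact N₁ N₂ N₃ f g hf hg hfg h₁ h₃ =>
    intro h
    rw [Module.support_of_exact hfg hf hg, Set.union_subset_iff] at h
    rw [← Module.length_ne_top_iff, Module.length_eq_add_of_exact f g hf hg hfg]
    have a := Module.length_ne_top_iff.2 (h₁ h.1)
    have b := Module.length_ne_top_iff.2 (h₃ h.2)
    simp [a, b]

theorem isFiniteLength_quotient {I : Ideal R} (hI : I.radical = maximalIdeal R)
    {X : Type v} [AddCommGroup X] [Module R X] [Module.Finite R X] {n : ℕ} {J : Submodule R X}
    (hJ : I ^ n • ⊤ ≤ J) : IsFiniteLength R (X ⧸ J) := by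
  have h : IsFiniteLength R (X ⧸ (I ^ n • ⊤ : Submodule R X)) := by
    apply isFiniteLength_of_support_subset
    intro p hp
    rw [Module.support_quotient] at hp
    have h1 : I ^ n ≤ p.asIdeal := hp.2
    have h2 : I ≤ p.asIdeal := p.2.le_of_pow_le h1
    have h3 : maximalIdeal R ≤ p.asIdeal := by
      rw [← hI]; exact p.2.radical_le_iff.2 h2
    rw [Set.mem_singleton_iff]
    ext1
    exact ((IsLocalRing.maximalIdeal.isMaximal R).eq_of_le p.2.ne_top h3).symm
  exact h.of_surjective (Submodule.factor_surjective hJ)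

theorem hsFun_mono {I : Ideal R} (hI : I.radical = maximalIdeal R) {X : Type v} [AddCommGroup X]
    [Module R X] [Module.Finite R X] : Monotone (hsFun I X) := fun _ _ h =>
  len_quotient_le (Submodule.smul_mono_left (Ideal.pow_le_pow_right h))
    (isFiniteLength_quotient hI le_rfl)

/-- The Hilbert-Samuel functions in a short exact sequence `0 → X → Y → Z → 0`. The filtration
induced on `X` by that of `Y` need not be `I`-adic. -/
theorem hsFun_of_exact {I : Ideal R} (hI : I.radical = maximalIdeal R) {X Y Z : Type*}
    [AddCommGroup X] [Module R X] [AddCommGroup Y]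
    [Module R Y] [Module.Finite R Y] [AddCommGroup Z] [Module R Z]
    (f : X →ₗ[R] Y) (g : Y →ₗ[R] Z) (hg : Function.Surjective g)
    (H : Function.Exact f g) (n : ℕ) :
    hsFun I Y n = len R (X ⧸ (I ^ n • (⊤ : Submodule R Y)).comap f) + hsFun I Z n := by
  have e : (Y ⧸ LinearMap.range f) ≃ₗ[R] Z :=
    (Submodule.quotEquivOfEq _ _ (LinearMap.exact_iff.1 H).symm).trans
      (g.quotKerEquivOfSurjective hg)
  rw [← hsFun_congr I e, hsFun_quotient]
  exact len_quotient_eq f _ (isFiniteLength_quotient hI le_rfl)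

end Finite

end CUlrich

/-! ### Superficial elements -/

namespace CUlrich

open IsLocalRing Filter

/-- Over a local ring with infinite residue field, a module is not a finite union of proper
submodules: a finite cover would have a member of finite index, while a nonzero module is
infinite. -/
theorem exists_forall_notMem_of_ne_top {R : Type u} [CommRing R] [IsLocalRing R]
    [Infinite (ResidueField R)] {E : Type v} [AddCommGroup E] [Module R E]
    {ι : Type*} (s : Finset ι) (U : ι → Submodule R E) (h : ∀ i ∈ s, U i ≠ ⊤) :
    ∃ y : E, ∀ i ∈ s, y ∉ U i := by
  classical
  by_contra! hc
  have hcov : ⋃ p ∈ s.image U, (p : Set E) = Set.univ := by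
    ext y
    obtain ⟨i, hi, hy⟩ := hc y
    simp only [Set.mem_iUnion, Set.mem_univ, iff_true]
    exact ⟨U i, Finset.mem_image_of_mem _ hi, hy⟩
  obtain ⟨p, hp, hfi⟩ := Submodule.exists_finiteIndex_of_cover hcov
  obtain ⟨i, hi, rfl⟩ := Finset.mem_image.1 hp
  have : Finite (E ⧸ U i) := AddSubgroup.finite_quotient_of_finiteIndex
  have : Nontrivial (E ⧸ U i) := Submodule.Quotient.nontrivial_iff.mpr (h i hi)
  obtain ⟨x, hx⟩ := exists_ne (0 : E ⧸ U i)
  have hinj : Function.Injective (fun a : ResidueField R => Quotient.out a • x) := by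
    intro a b hab
    by_contra hne
    have hu : IsUnit (Quotient.out a - Quotient.out b) := by
      by_contra hn
      have h1 : Quotient.out a - Quotient.out b ∈ maximalIdeal R := hn
      rw [← Ideal.Quotient.eq] at h1
      apply hne
      rw [← Quotient.out_eq a, ← Quotient.out_eq b]
      exact h1
    apply hx
    rw [← hu.smul_eq_zero, sub_smul, sub_eq_zero]
    exact hab
  exact not_finite_iff_infinite.2 ‹Infinite (ResidueField R)› (Finite.of_injective _ hinj)

section Rees

variable {R : Type u} [CommRing R]

/-- The degree one component `a ↦ a X` of the Rees algebra. -/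
noncomputable def reesOne (I : Ideal R) : I →ₗ[R] reesAlgebra I where
  toFun a := ⟨Polynomial.monomial 1 (a : R), by
    rw [mem_reesAlgebra_iff]
    intro i
    rw [Polynomial.coeff_monomial]
    split_ifs with h
    · subst h; simp
    · exact zero_mem _⟩
  map_add' a b := by ext1; simp
  map_smul' r a := by
    ext1
    simp [Polynomial.smul_monomial]

variable {X : Type v} [AddCommGroup X] [Module R X]

theorem single_mem_submodule_iff {I : Ideal R} (F : I.Filtration X) (n : ℕ) (x : X) :
    PolynomialModule.single R n x ∈ F.submodule ↔ x ∈ F.N n := by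
  rw [Ideal.Filtration.mem_submodule]
  constructor
  · intro h; simpa using h n
  · intro h i
    rw [PolynomialModule.coeff_single, Finsupp.single_apply]
    split_ifs with hi
    · exact hi ▸ h
    · exact zero_mem _

theorem reesOne_smul_single (I : Ideal R) (a : I) (n : ℕ) (x : X) :
    reesOne I a • PolynomialModule.single R n x =
      PolynomialModule.single R (n + 1) ((a : R) • x) := by
  rw [Subalgebra.smul_def]
  change Polynomial.monomial 1 (a : R) • _ = _
  rw [PolynomialModule.monomial_smul_single, add_comm]

/-- A homogeneous element of degree `n` of the Rees module lies in the `n`-th power of the ideal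
of positive degree elements. -/
theorem single_mem_pow_smul (I : Ideal R) (n : ℕ) (x : X) (hx : x ∈ I ^ n • (⊤ : Submodule R X)) :
    PolynomialModule.single R n x ∈ Ideal.span (Set.range (reesOne I)) ^ n •
      (I.stableFiltration (⊤ : Submodule R X)).submodule := by
  induction n generalizing x with
  | zero =>
    rw [pow_zero, Ideal.one_eq_top, Submodule.top_smul, single_mem_submodule_iff]
    simp
  | succ n ih =>
    rw [pow_succ', ← smul_eq_mul, Submodule.smul_assoc] at hx
    refine Submodule.smul_induction_on hx ?_ ?_
    · intro a ha z hz
      rw [← reesOne_smul_single I ⟨a, ha⟩, pow_succ', ← smul_eq_mul,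
        Submodule.smul_assoc]
      exact Submodule.smul_mem_smul (Ideal.subset_span ⟨_, rfl⟩) (ih z hz)
    · intro a b ha hb
      rw [PolynomialModule.single_add]
      exact add_mem ha hb

end Rees

/-- Multiplication by an element avoiding the associated primes of a finite module `G` that do not
contain an ideal `B` is injective on `B ^ c • G` for some `c`. -/
theorem exists_pow_smul_injOn {A : Type*} [CommRing A] [IsNoetherianRing A] {G : Type*}
    [AddCommGroup G] [Module A G] [Module.Finite A G] (B : Ideal A) (y : A)
    (hy : ∀ P ∈ associatedPrimes A G, y ∈ P → B ≤ P) :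
    ∃ c : ℕ, ∀ g ∈ B ^ c • (⊤ : Submodule A G), y • g = 0 → g = 0 := by
  let K : Submodule A G := LinearMap.ker (LinearMap.lsmul A G y)
  have hBK : B ≤ (Module.annihilator A K).radical := by
    rw [← Ideal.sInf_minimalPrimes]
    refine le_sInf fun P hP => ?_
    have hPK := Module.associatedPrimes.minimalPrimes_annihilator_subset_associatedPrimes _ _ hP
    refine hy P (associatedPrimes.subset_of_injective (f := K.subtype) K.injective_subtype hPK) ?_
    have h1 : Module.annihilator A K ≤ P := hP.1.2
    apply h1
    rw [Module.mem_annihilator]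
    intro k
    ext1
    exact k.2
  obtain ⟨N, hN⟩ := Ideal.exists_pow_le_of_le_radical_of_fg hBK (IsNoetherian.noetherian _)
  obtain ⟨k, hk⟩ := B.exists_pow_inf_eq_pow_smul K
  have hzero : B ^ (k + N) • (⊤ : Submodule A G) ⊓ K = ⊥ := by
    rw [hk _ (by omega), Nat.add_sub_cancel_left, eq_bot_iff]
    refine (smul_mono_right (B ^ N) (inf_le_right : _ ⊓ K ≤ K)).trans ?_
    rw [Submodule.smul_le]
    intro r hr z hz
    have := Module.mem_annihilator.1 (hN hr) ⟨z, hz⟩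
    rw [Submodule.mem_bot]
    exact congrArg Subtype.val this
  refine ⟨k + N, fun g hg hyg => ?_⟩
  rw [← Submodule.mem_bot A, ← hzero]
  exact ⟨hg, hyg⟩

/-- The version of `exists_pow_smul_injOn` for the quotient of a finitely generated submodule `𝓜`
by `𝓝 ⊓ 𝓜`. -/
theorem exists_finite_primes_pow_smul_injOn {A : Type*} [CommRing A] [IsNoetherianRing A]
    {E : Type*} [AddCommGroup E] [Module A E] {𝓜 : Submodule A E} (h𝓜 : 𝓜.FG)
    (𝓝 : Submodule A E) (B : Ideal A) :
    ∃ T : Set (Ideal A), T.Finite ∧ (∀ P ∈ T, ¬ B ≤ P) ∧ ∀ y : A, (∀ P ∈ T, y ∉ P) →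
      ∃ c : ℕ, ∀ e ∈ B ^ c • 𝓜, y • e ∈ 𝓝 → e ∈ 𝓝 := by
  have : Module.Finite A 𝓜 := Module.Finite.iff_fg.2 h𝓜
  let G := 𝓜 ⧸ (𝓝.comap 𝓜.subtype)
  refine ⟨{P ∈ associatedPrimes A G | ¬ B ≤ P}, (associatedPrimes.finite A G).subset
    (Set.sep_subset _ _), fun P hP => hP.2, fun y hy => ?_⟩
  obtain ⟨c, hc⟩ := exists_pow_smul_injOn (G := G) B y
    (fun P hP hyP => by_contra fun h => hy P ⟨hP, h⟩ hyP)
  refine ⟨c, fun e he hye => ?_⟩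
  have h4 : B ^ c • 𝓜 = (B ^ c • (⊤ : Submodule A 𝓜)).map 𝓜.subtype := by
    rw [Submodule.map_smul'', Submodule.map_top, Submodule.range_subtype]
  rw [h4] at he
  obtain ⟨w, hw, rfl⟩ := he
  have h6 := hc _ (smul_top_le_comap (B ^ c) (𝓝.comap 𝓜.subtype).mkQ hw) (by
    rw [← map_smul]
    exact (Submodule.Quotient.mk_eq_zero _).2 hye)
  exact (Submodule.Quotient.mk_eq_zero (𝓝.comap 𝓜.subtype)).1 h6

/-- Existence of superficial elements. The associated graded module is a finite module over the
Rees algebra; an element `y` of `I` whose image in degree one avoids the associated primes not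
containing the irrelevant ideal acts injectively on it in large degrees. -/
theorem exists_superficial {R : Type u} [CommRing R] [IsLocalRing R] [IsNoetherianRing R]
    [Infinite (ResidueField R)] (I : Ideal R) (X : Type v) [AddCommGroup X] [Module R X]
    [Module.Finite R X] {S : Set (Ideal R)} (hS : S.Finite) (hIS : ∀ P ∈ S, ¬ I ≤ P) :
    ∃ y ∈ I, (∀ P ∈ S, y ∉ P) ∧ ∃ c : ℕ, ∀ n ≥ c, ∀ x ∈ I ^ c • (⊤ : Submodule R X),
      y • x ∈ I ^ (n + 1) • (⊤ : Submodule R X) → x ∈ I ^ n • (⊤ : Submodule R X) := by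
  classical
  obtain ⟨T, hT, hBT, hT'⟩ := exists_finite_primes_pow_smul_injOn (A := reesAlgebra I)
    ((Ideal.Filtration.submodule_fg_iff_stable _ (fun i => IsNoetherian.noetherian _)).2
      (Ideal.stableFiltration_stable I (⊤ : Submodule R X)))
    (I.stableFiltration (I • (⊤ : Submodule R X))).submodule (Ideal.span (Set.range (reesOne I)))
  let U : Ideal R ⊕ Ideal (reesAlgebra I) → Submodule R I := fun t =>
    t.elim (fun P => Submodule.comap I.subtype P)
      (fun P => (P.restrictScalars R).comap (reesOne I))
  let s : Finset (Ideal R ⊕ Ideal (reesAlgebra I)) := hS.toFinset.disjSum hT.toFinset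
  obtain ⟨y, hy⟩ := exists_forall_notMem_of_ne_top s U (by
    rintro (P | P) hP
    · rw [Finset.inl_mem_disjSum, Set.Finite.mem_toFinset] at hP
      intro h
      refine hIS P hP fun a ha => ?_
      have : (⟨a, ha⟩ : I) ∈ U (Sum.inl P) := h ▸ Submodule.mem_top
      exact this
    · rw [Finset.inr_mem_disjSum, Set.Finite.mem_toFinset] at hP
      intro h
      refine hBT P hP (Ideal.span_le.2 ?_)
      rintro _ ⟨a, rfl⟩
      have : a ∈ U (Sum.inr P) := h ▸ Submodule.mem_top
      exact this)
  refine ⟨y, y.2, fun P hP => hy (Sum.inl P) (by simpa [s] using hP), ?_⟩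
  obtain ⟨c, hc⟩ := hT' (reesOne I y) (fun P hP => hy (Sum.inr P) (by simpa [s] using hP))
  have mem_iff : ∀ (n : ℕ) (z : X), PolynomialModule.single R n z ∈
      (I.stableFiltration (I • (⊤ : Submodule R X))).submodule ↔
        z ∈ I ^ (n + 1) • (⊤ : Submodule R X) := by
    intro n z
    rw [single_mem_submodule_iff]
    change _ ∈ I ^ n • I • (⊤ : Submodule R X) ↔ _
    rw [← Submodule.smul_assoc, smul_eq_mul, ← pow_succ]
  have step : ∀ j ≥ c, ∀ x ∈ I ^ j • (⊤ : Submodule R X),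
      (y : R) • x ∈ I ^ (j + 2) • (⊤ : Submodule R X) → x ∈ I ^ (j + 1) • (⊤ : Submodule R X) := by
    intro j hj x hx hyx
    rw [← mem_iff]
    refine hc _ (Submodule.smul_mono_left (Ideal.pow_le_pow_right hj)
      (single_mem_pow_smul I j x hx)) ?_
    rwa [reesOne_smul_single, mem_iff]
  refine ⟨c, fun n hn x hx hyx => ?_⟩
  have : ∀ j, c ≤ j → j ≤ n → x ∈ I ^ j • (⊤ : Submodule R X) := by
    intro j hj
    induction j, hj using Nat.le_induction with
    | base => intro _; exact hx
    | succ j hj ih =>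
      intro hjn
      exact step j hj x (ih (by omega))
        (Submodule.smul_mono_left (Ideal.pow_le_pow_right (by omega)) hyx)
  exact this n hn le_rfl

end CUlrich

/-! ### The Hilbert-Samuel function over an infinite residue field -/

namespace CUlrich

open IsLocalRing Filter RingTheory.Sequence
open scoped Pointwise

theorem isSMulRegular_of_forall_associatedPrimes {R : Type u} [CommRing R]
    [IsNoetherianRing R] {T : Type v} [AddCommGroup T] [Module R T] {z : R}
    (h : ∀ P ∈ associatedPrimes R T, z ∉ P) : IsSMulRegular T z := by
  rw [isSMulRegular_iff_right_eq_zero_of_smul]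
  intro x hx
  by_contra hne
  have : z ∈ ⋃ p ∈ associatedPrimes R T, (p : Set R) := by
    rw [biUnion_associatedPrimes_eq_zero_divisors]
    exact ⟨x, hne, hx⟩
  simp only [Set.mem_iUnion] at this
  obtain ⟨P, hP, hz⟩ := this
  exact h P hP hz

theorem notMem_of_mem_associatedPrimes {R : Type u} [CommRing R] [IsNoetherianRing R]
    {T : Type v} [AddCommGroup T] [Module R T] {z : R}
    (h : IsSMulRegular T z) {P : Ideal R} (hP : P ∈ associatedPrimes R T) : z ∉ P := by
  intro hz
  have : z ∈ ⋃ p ∈ associatedPrimes R T, (p : Set R) := by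
    simp only [Set.mem_iUnion]; exact ⟨P, hP, hz⟩
  rw [biUnion_associatedPrimes_eq_zero_divisors] at this
  obtain ⟨x, hx, hzx⟩ := this
  exact hx (isSMulRegular_iff_right_eq_zero_of_smul.1 h x hzx)

section

variable {R : Type u} [CommRing R] [IsLocalRing R] [IsNoetherianRing R]

/-- A superficial element `y` relates the Hilbert-Samuel functions of `X` and `X / y X`. -/
theorem exists_hsFun_superficial [Infinite (ResidueField R)] {I : Ideal R}
    (hI : I.radical = maximalIdeal R) (X : Type v) [AddCommGroup X] [Module R X]
    [Module.Finite R X] {S : Set (Ideal R)} (hS : S.Finite) (hIS : ∀ P ∈ S, ¬ I ≤ P) :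
    ∃ y ∈ I, (∀ P ∈ S, y ∉ P) ∧ ∃ n₀ : ℕ, ∀ n ≥ n₀,
      I ^ n • (⊤ : Submodule R X) ⊓ LinearMap.ker (LinearMap.lsmul R X y) = ⊥ ∧
      hsFun I X (n + 1) - hsFun I X n =
        hsFun I (X ⧸ LinearMap.range (LinearMap.lsmul R X y)) (n + 1) -
          len R (LinearMap.ker (LinearMap.lsmul R X y)) := by
  have hItop : I ≠ ⊤ := by
    rintro rfl
    rw [Ideal.radical_top] at hI
    exact (IsLocalRing.maximalIdeal.isMaximal R).ne_top hI.symm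
  obtain ⟨y, hyI, hyS, c, hc⟩ := exists_superficial I X hS hIS
  refine ⟨y, hyI, hyS, ?_⟩
  let μ := LinearMap.lsmul R X y
  obtain ⟨k, hk⟩ := I.exists_pow_inf_eq_pow_smul (LinearMap.range μ)
  refine ⟨c + k, fun n hn => ?_⟩
  have hbot : I ^ n • (⊤ : Submodule R X) ⊓ LinearMap.ker μ = ⊥ := by
    rw [eq_bot_iff, ← Ideal.iInf_pow_smul_eq_bot_of_isLocalRing I hItop]
    rintro x ⟨hx, hyx⟩
    rw [Submodule.mem_iInf]
    intro m
    have hx' := Submodule.smul_mono_left (Ideal.pow_le_pow_right (show c ≤ n by omega)) hx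
    have := hc (m + c) (by omega) x hx' (by
      have : y • x = 0 := hyx
      rw [this]; exact zero_mem _)
    exact Submodule.smul_mono_left (Ideal.pow_le_pow_right (by omega)) this
  refine ⟨hbot, ?_⟩
  have hcomap : (I ^ (n + 1) • (⊤ : Submodule R X)).comap μ =
      I ^ n • ⊤ ⊔ LinearMap.range (LinearMap.ker μ).subtype := by
    rw [Submodule.range_subtype]
    apply le_antisymm
    · intro x hx
      have h1 : μ x ∈ I ^ (n + 1) • (⊤ : Submodule R X) ⊓ LinearMap.range μ := ⟨hx, x, rfl⟩
      rw [hk (n + 1) (by omega)] at h1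
      have h2 : μ x ∈ (I ^ (n + 1 - k) • (⊤ : Submodule R X)).map μ := by
        rw [Submodule.map_smul'', Submodule.map_top]
        exact smul_mono_right (I ^ (n + 1 - k))
          (inf_le_right : _ ⊓ LinearMap.range μ ≤ _) h1
      obtain ⟨v, hv, hvx⟩ := h2
      have hv' : v ∈ I ^ n • (⊤ : Submodule R X) := by
        refine hc n (by omega) v ?_ ?_
        · exact Submodule.smul_mono_left (Ideal.pow_le_pow_right (by omega)) hv
        · have : y • v = μ x := hvx
          rw [this]; exact hx
      rw [Submodule.mem_sup]
      refine ⟨v, hv', x - v, ?_, by abel⟩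
      rw [LinearMap.mem_ker, map_sub, hvx, sub_self]
    · refine sup_le ?_ ?_
      · intro x hx
        rw [Submodule.mem_comap, pow_succ', ← smul_eq_mul, Submodule.smul_assoc]
        exact Submodule.smul_mem_smul hyI hx
      · intro x hx
        rw [Submodule.mem_comap, LinearMap.mem_ker.1 hx]
        exact zero_mem _
  have e1 : hsFun I X (n + 1) = _ :=
    len_quotient_eq μ (I ^ (n + 1) • ⊤) (isFiniteLength_quotient hI le_rfl)
  have e2 : hsFun I X n = _ := len_quotient_eq (LinearMap.ker μ).subtype (I ^ n • ⊤)
    (isFiniteLength_quotient hI le_rfl)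
  have e3 : (I ^ n • (⊤ : Submodule R X)).comap (LinearMap.ker μ).subtype = ⊥ := by
    rw [eq_bot_iff]
    intro z hz
    have : (z : X) ∈ (⊥ : Submodule R X) := hbot ▸ ⟨hz, z.2⟩
    rw [Submodule.mem_bot] at this ⊢
    exact Subtype.ext this
  rw [hcomap] at e1
  rw [e3, len_congr (Submodule.quotEquivOfEqBot _ rfl)] at e2
  rw [e1, e2, hsFun_quotient]
  change _ = len R (X ⧸ (I ^ (n + 1) • ⊤ ⊔ LinearMap.range μ)) - len R (LinearMap.ker μ)
  ring

/-- The proof is by Noetherian induction on the kernel `U` of `X → X / U`, a superficial element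
reducing the statement to a proper quotient of `X / U` unless it kills `X / U`. -/
theorem eventuallyPolynomial_hsFun_of_infinite [Infinite (ResidueField R)] {I : Ideal R}
    (hI : I.radical = maximalIdeal R) (X : Type v) [AddCommGroup X] [Module R X]
    [Module.Finite R X] : EventuallyPolynomial (hsFun I X) := by
  suffices H : ∀ U : Submodule R X, EventuallyPolynomial (hsFun I (X ⧸ U)) by
    have := H ⊥
    rwa [funext (hsFun_congr I (Submodule.quotEquivOfEqBot (⊥ : Submodule R X) rfl))] at this
  intro U
  induction U using IsNoetherian.induction with
  | hgt U ih =>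
  obtain ⟨y, -, -, n₀, hn₀⟩ := exists_hsFun_superficial hI (X ⧸ U) Set.finite_empty
    (by simp)
  by_cases hy : LinearMap.range (LinearMap.lsmul R (X ⧸ U) y) = ⊥
  -- then `I ^ n (X / U) = 0` for large `n`, and the function is eventually constant
  · refine (eventuallyPolynomial_const (len R (X ⧸ U))).congr ?_
    filter_upwards [eventually_ge_atTop n₀] with n hn
    have h1 := (hn₀ n hn).1
    rw [LinearMap.range_eq_bot.1 hy, LinearMap.ker_zero, inf_top_eq] at h1
    exact (len_congr (Submodule.quotEquivOfEqBot _ h1)).symm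
  · let U' := (LinearMap.range (LinearMap.lsmul R (X ⧸ U) y)).comap U.mkQ
    have hUU' : U ≤ U' := by
      intro u hu
      rw [Submodule.mem_comap, Submodule.mkQ_apply, (Submodule.Quotient.mk_eq_zero U).2 hu]
      exact zero_mem _
    have hmap : U'.map U.mkQ = LinearMap.range (LinearMap.lsmul R (X ⧸ U) y) :=
      Submodule.map_comap_eq_of_surjective U.mkQ_surjective _
    have hlt : U < U' := by
      refine lt_of_le_of_ne hUU' fun h => hy ?_
      rw [← hmap, ← h, Submodule.mkQ_map_self]
    refine (ih U' hlt).of_fwdDiff (len R (LinearMap.ker (LinearMap.lsmul R (X ⧸ U) y))) ?_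
    filter_upwards [eventually_ge_atTop n₀] with n hn
    rw [(hn₀ n hn).2, hsFun_congr I ((Submodule.quotEquivOfEq _ _ hmap.symm).trans
      (Submodule.quotientQuotientEquivQuotient U U' hUU'))]

/-- The module `T` has a regular sequence of length `d` in the maximal ideal. Weak regularity
suffices, since for `T ≠ 0` Nakayama's lemma gives the rest. -/
def DepthGE (R : Type u) [CommRing R] [IsLocalRing R] (T : Type v) [AddCommGroup T] [Module R T]
    (d : ℕ) : Prop :=
  ∃ rs : List R, rs.length = d ∧ (∀ r ∈ rs, r ∈ maximalIdeal R) ∧ IsWeaklyRegular T rs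

theorem weaklyRegular_perm {T : Type v} [AddCommGroup T] [Module R T] [Module.Finite R T]
    {rs rs' : List R} (h : IsWeaklyRegular T rs) (hm : ∀ r ∈ rs, r ∈ maximalIdeal R)
    (hp : rs.Perm rs') : IsWeaklyRegular T rs' := by
  rcases subsingleton_or_nontrivial T with hT | hT
  · rw [isWeaklyRegular_iff]
    intro i hi a b _
    exact Subsingleton.elim _ _
  · exact (IsLocalRing.isRegular_of_perm
      ((IsLocalRing.isRegular_iff_isWeaklyRegular_of_subset_maximalIdeal hm).2 h)
      hp).toIsWeaklyRegular

/-- If `x, w` is a regular sequence and `y` is regular, then the maximal ideal is not associated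
to `T / y T`. -/
theorem maximalIdeal_notMem_associatedPrimes {T : Type v} [AddCommGroup T] [Module R T]
    {x y w : R} (hx : x ∈ maximalIdeal R) (hw : w ∈ maximalIdeal R)
    (hxT : IsSMulRegular T x)
    (hwT : IsSMulRegular (QuotSMulTop x T) w) (hyT : IsSMulRegular T y) :
    maximalIdeal R ∉ associatedPrimes R (QuotSMulTop y T) := by
  intro h
  rw [AssociatedPrimes.mem_iff, isAssociatedPrime_iff] at h
  obtain ⟨-, t, ht⟩ := h
  obtain ⟨t, rfl⟩ := Submodule.mkQ_surjective _ t
  have hmem : ∀ a : R, a ∈ maximalIdeal R ↔ ∃ v : T, y • v = a • t := by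
    intro a
    rw [ht, Submodule.mem_colon_singleton, Submodule.mem_bot, ← map_smul, Submodule.mkQ_apply,
      Submodule.Quotient.mk_eq_zero]
    constructor
    · rintro ⟨v, -, hv⟩; exact ⟨v, hv⟩
    · rintro ⟨v, hv⟩; exact ⟨v, trivial, hv⟩
  obtain ⟨u, hu⟩ := (hmem x).1 hx
  -- the class of `u` in `T / x T` is killed by the maximal ideal, in particular by `w`
  obtain ⟨v, hv⟩ := (hmem w).1 hw
  have h1 : w • u = x • v := by
    apply hyT
    change y • w • u = y • x • v
    rw [smul_comm, hu, smul_comm y x v, hv, smul_comm]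
  have h2 : (Submodule.Quotient.mk u : QuotSMulTop x T) = 0 := by
    apply isSMulRegular_iff_right_eq_zero_of_smul.1 hwT
    change (Submodule.Quotient.mk (w • u) : QuotSMulTop x T) = 0
    rw [Submodule.Quotient.mk_eq_zero]
    exact ⟨v, trivial, h1.symm⟩
  rw [Submodule.Quotient.mk_eq_zero] at h2
  obtain ⟨t', -, ht'⟩ := h2
  have ht'' : x • t' = u := ht'
  have h3 : y • t' = t := by
    apply hxT
    change x • y • t' = x • t
    rw [smul_comm, ht'', hu]
  have : (1 : R) ∈ maximalIdeal R := (hmem 1).2 ⟨t', by rw [h3, one_smul]⟩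
  exact (IsLocalRing.maximalIdeal.isMaximal R).ne_top ((Ideal.eq_top_iff_one _).2 this)

/-- Passing to the quotient by a regular element lowers the depth by at most one. The proof
replaces a regular sequence by one starting with an element `z` that is also regular modulo `y`. -/
theorem DepthGE.quotSMulTop {d : ℕ} : ∀ {T : Type v} [AddCommGroup T] [Module R T]
    [Module.Finite R T], DepthGE R T (d + 1) → ∀ {y : R}, y ∈ maximalIdeal R →
    IsSMulRegular T y → DepthGE R (QuotSMulTop y T) d := by
  induction d with
  | zero =>
    intro T _ _ _ _ y _ _
    exact ⟨[], rfl, by simp, IsWeaklyRegular.nil R _⟩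
  | succ d ih =>
    intro T _ _ _ hT y hy hyT
    obtain ⟨rs, hlen, hm, hreg⟩ := hT
    obtain ⟨x, rs, rfl⟩ := List.exists_cons_of_ne_nil (l := rs) (by rintro rfl; simp at hlen)
    obtain ⟨w, rs, rfl⟩ := List.exists_cons_of_ne_nil (l := rs) (by rintro rfl; simp at hlen)
    simp only [List.length_cons, add_left_inj] at hlen
    have hreg' := hreg
    rw [isWeaklyRegular_cons_iff, isWeaklyRegular_cons_iff] at hreg'
    obtain ⟨hxT, hwT, hrs⟩ := hreg'
    have hx : x ∈ maximalIdeal R := hm x (by simp)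
    have hw : w ∈ maximalIdeal R := hm w (by simp)
    -- prime avoidance yields `z` regular modulo `x` and modulo `y`
    obtain ⟨z, hz, hzT⟩ : ∃ z ∈ maximalIdeal R, z ∉ ⋃ P ∈ associatedPrimes R (QuotSMulTop x T) ∪
        associatedPrimes R (QuotSMulTop y T), (P : Set R) := by
      by_contra! hc
      have hfin := (associatedPrimes.finite R (QuotSMulTop x T)).union
        (associatedPrimes.finite R (QuotSMulTop y T))
      obtain ⟨P, hP, hmP⟩ := (Ideal.subset_union_prime_finite hfin (f := id) 0 0
        (fun P hP _ _ => by
          rcases hP with hP | hP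
          · exact hP.isPrime
          · exact hP.isPrime)).1 hc
      have hPm : maximalIdeal R = P :=
        (IsLocalRing.maximalIdeal.isMaximal R).eq_of_le (by
          rcases hP with hP | hP
          · exact hP.isPrime.ne_top
          · exact hP.isPrime.ne_top) hmP
      rcases hP with hP | hP
      · exact notMem_of_mem_associatedPrimes hwT hP (hPm ▸ hw)
      · exact maximalIdeal_notMem_associatedPrimes hx hw hxT hwT hyT (hPm ▸ hP)
    simp only [Set.mem_iUnion, not_exists] at hzT
    have hzx : IsSMulRegular (QuotSMulTop x T) z :=
      isSMulRegular_of_forall_associatedPrimes fun P hP => hzT P (Or.inl hP)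
    have hzy : IsSMulRegular (QuotSMulTop y T) z :=
      isSMulRegular_of_forall_associatedPrimes fun P hP => hzT P (Or.inr hP)
    obtain ⟨s, hs, hsm, hsreg⟩ := ih (T := QuotSMulTop x T) ⟨w :: rs, by simp [hlen],
      fun r hr => hm r (by simp at hr ⊢; tauto), by
        rw [isWeaklyRegular_cons_iff]; exact ⟨hwT, hrs⟩⟩ hz hzx
    have h1 : IsWeaklyRegular T (z :: x :: s) := by
      refine weaklyRegular_perm (rs := x :: z :: s) ?_ ?_ (List.Perm.swap _ _ _)
      · rw [isWeaklyRegular_cons_iff, isWeaklyRegular_cons_iff]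
        exact ⟨hxT, hzx, hsreg⟩
      · intro r hr
        simp only [List.mem_cons] at hr
        rcases hr with rfl | rfl | hr
        exacts [hx, hz, hsm r hr]
    have h2 : IsWeaklyRegular T [z, y] := by
      refine weaklyRegular_perm (rs := [y, z]) ?_ ?_ (List.Perm.swap _ _ _)
      · rw [isWeaklyRegular_cons_iff, isWeaklyRegular_cons_iff]
        exact ⟨hyT, hzy, IsWeaklyRegular.nil R _⟩
      · intro r hr
        simp only [List.mem_cons, List.not_mem_nil, or_false] at hr
        rcases hr with rfl | rfl
        exacts [hy, hz]
    rw [isWeaklyRegular_cons_iff] at h1 h2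
    obtain ⟨s', hs', hsm', hsreg'⟩ := ih (T := QuotSMulTop z T) ⟨x :: s, by simp [hs], by
      intro r hr
      simp only [List.mem_cons] at hr
      rcases hr with rfl | hr
      exacts [hx, hsm r hr], h1.2⟩ hy ((isWeaklyRegular_cons_iff _ _ _).1 h2.2).1
    have h3 : IsWeaklyRegular T (y :: z :: s') := by
      refine weaklyRegular_perm (rs := z :: y :: s') ?_ ?_ (List.Perm.swap _ _ _)
      · rw [isWeaklyRegular_cons_iff, isWeaklyRegular_cons_iff]
        exact ⟨h1.1, ((isWeaklyRegular_cons_iff _ _ _).1 h2.2).1, hsreg'⟩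
      · intro r hr
        simp only [List.mem_cons] at hr
        rcases hr with rfl | rfl | hr
        exacts [hz, hy, hsm' r hr]
    rw [isWeaklyRegular_cons_iff] at h3
    refine ⟨z :: s', by simp [hs'], ?_, h3.2⟩
    intro r hr
    simp only [List.mem_cons] at hr
    rcases hr with rfl | hr
    exacts [hz, hsm' r hr]

/-- A lower bound for the Hilbert-Samuel function of a module of depth at least `d`, with leading
coefficient `ℓ(T / I T)`. -/
theorem DepthGE.exists_choose_mul_le_of_infinite [Infinite (ResidueField R)] {I : Ideal R}
    (hI : I.radical = maximalIdeal R) {d : ℕ} : ∀ {T : Type v} [AddCommGroup T] [Module R T]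
    [Module.Finite R T], DepthGE R T d →
    ∃ n₀ : ℕ, ∀ n, ((n + d).choose d : ℤ) * hsFun I T 1 ≤ hsFun I T (n + n₀) := by
  induction d with
  | zero =>
    intro T _ _ _ _
    refine ⟨1, fun n => ?_⟩
    simpa using hsFun_mono hI (X := T) (show 1 ≤ n + 1 by omega)
  | succ d ih =>
    intro T _ _ _ hT
    have hIS : ∀ P ∈ associatedPrimes R T, ¬ I ≤ P := by
      intro P hP hIP
      obtain ⟨rs, hlen, hm, hreg⟩ := hT
      obtain ⟨x, rs, rfl⟩ := List.exists_cons_of_ne_nil (l := rs) (by rintro rfl; simp at hlen)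
      rw [isWeaklyRegular_cons_iff] at hreg
      refine notMem_of_mem_associatedPrimes hreg.1 hP ?_
      have h1 : I.radical ≤ P := hP.isPrime.radical_le_iff.2 hIP
      exact h1 (hI ▸ hm x (by simp))
    obtain ⟨y, hyI, hyS, n₀, hn₀⟩ := exists_hsFun_superficial hI T
      (associatedPrimes.finite R T) hIS
    have hyT : IsSMulRegular T y := isSMulRegular_of_forall_associatedPrimes hyS
    have hker : LinearMap.ker (LinearMap.lsmul R T y) = ⊥ :=
      LinearMap.ker_eq_bot.2 hyT
    have hrange : y • (⊤ : Submodule R T) = LinearMap.range (LinearMap.lsmul R T y) := by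
      rw [← Submodule.map_top]; rfl
    have hym : y ∈ maximalIdeal R := hI ▸ Ideal.le_radical hyI
    obtain ⟨n₁, hn₁⟩ := ih (hT.quotSMulTop hym hyT)
    have h1 : hsFun I (QuotSMulTop y T) 1 = hsFun I T 1 := by
      refine (hsFun_quotient I _ 1).trans (len_congr (Submodule.quotEquivOfEq _ _ ?_))
      rw [sup_eq_left]
      rintro _ ⟨t, -, rfl⟩
      rw [pow_one]
      exact Submodule.smul_mem_smul hyI trivial
    rw [h1] at hn₁
    refine ⟨n₀ + n₁ + 1, fun n => ?_⟩
    induction n with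
    | zero => simpa using hsFun_mono hI (X := T) (show 1 ≤ n₀ + n₁ + 1 by omega)
    | succ n ihn =>
      have h2 := (hn₀ (n + (n₀ + n₁ + 1)) (by omega)).2
      rw [hker, show len R (⊥ : Submodule R T) = 0 by rw [len, Module.length_bot]; rfl, sub_zero,
        ← hsFun_congr I (Submodule.quotEquivOfEq _ _ hrange)] at h2
      have h3 := hn₁ (n + 1)
      have h4 := hsFun_mono hI (X := QuotSMulTop y T)
        (show n + 1 + n₁ ≤ n + (n₀ + n₁ + 1) + 1 by omega)
      have h5 : ((n + 1 + (d + 1)).choose (d + 1) : ℤ) =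
          (n + (d + 1)).choose (d + 1) + (n + 1 + d).choose d := by
        rw [show n + 1 + (d + 1) = (n + d + 1) + 1 by ring, Nat.choose_succ_succ,
          show n + (d + 1) = n + d + 1 by ring, show n + 1 + d = n + d + 1 by ring]
        push_cast; ring
      rw [h5, show n + 1 + (n₀ + n₁ + 1) = n + (n₀ + n₁ + 1) + 1 by ring]
      linarith

end

end CUlrich

/-! ### Enlarging the residue field -/

namespace CUlrich

open IsLocalRing Filter RingTheory.Sequence

theorem baseChange_smul_top {R S : Type u} [CommRing R] [CommRing S] [Algebra R S] (J : Ideal R)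
    (X : Type v) [AddCommGroup X] [Module R X] :
    (J • (⊤ : Submodule R X)).baseChange S = J.map (algebraMap R S) • ⊤ := by
  apply le_antisymm
  · rw [Submodule.baseChange_eq_span, Submodule.span_le]
    rintro _ ⟨x, hx, rfl⟩
    refine Submodule.smul_induction_on hx ?_ ?_
    · intro a ha y _
      rw [map_smul, SetLike.mem_coe, ← algebraMap_smul S a]
      exact Submodule.smul_mem_smul (Ideal.mem_map_of_mem (algebraMap R S) ha)
        Submodule.mem_top
    · intro a b ha hb
      rw [map_add]; exact add_mem ha hb
  · rw [Ideal.map, Submodule.span_smul_eq]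
    refine Submodule.set_smul_le _ _ _ ?_
    rintro _ t ⟨a, ha, rfl⟩ -
    induction t using TensorProduct.induction_on with
    | zero => rw [smul_zero]; exact zero_mem _
    | tmul s y =>
      rw [algebraMap_smul, ← TensorProduct.tmul_smul]
      exact Submodule.tmul_mem_baseChange_of_mem s (Submodule.smul_mem_smul ha trivial)
    | add b c hb hc => rw [smul_add]; exact add_mem hb hc

/-- A nonzero cyclic module over a local ring which is killed by the maximal ideal has length
one. -/
theorem length_eq_one_of_generator {S : Type u} [CommRing S] [IsLocalRing S] {Y : Type v}
    [AddCommGroup Y] [Module S Y] [Nontrivial Y] (y : Y)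
    (hs : Function.Surjective (LinearMap.toSpanSingleton S Y y))
    (hk : maximalIdeal S ≤ LinearMap.ker (LinearMap.toSpanSingleton S Y y)) :
    Module.length S Y = 1 := by
  have hne : LinearMap.ker (LinearMap.toSpanSingleton S Y y) ≠ ⊤ := by
    rw [ne_eq, LinearMap.ker_eq_top]
    intro h0
    obtain ⟨t, ht⟩ := exists_ne (0 : Y)
    obtain ⟨s, rfl⟩ := hs t
    exact ht (by rw [h0]; rfl)
  have heq := (IsLocalRing.maximalIdeal.isMaximal S).eq_of_le hne hk
  rw [Module.length_eq_one_iff, isSimpleModule_iff_quot_maximal]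
  exact ⟨maximalIdeal S, IsLocalRing.maximalIdeal.isMaximal S,
    ⟨((Submodule.quotEquivOfEq _ _ heq).trans (LinearMap.quotKerEquivOfSurjective _ hs)).symm⟩⟩

section FlatLocal

variable {R S : Type u} [CommRing R] [IsLocalRing R] [CommRing S] [IsLocalRing S] [Algebra R S]

theorem isLocalHom_of_map_maximalIdeal_eq
    (hm : (maximalIdeal R).map (algebraMap R S) = maximalIdeal S) :
    IsLocalHom (algebraMap R S) :=
  ((local_hom_TFAE (algebraMap R S)).out 2 0).1 hm.le

theorem radical_map_eq (hm : (maximalIdeal R).map (algebraMap R S) = maximalIdeal S) {I : Ideal R}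
    (hI : I.radical = maximalIdeal R) :
    (I.map (algebraMap R S)).radical = maximalIdeal S := by
  apply le_antisymm
  · refine (IsLocalRing.maximalIdeal.isMaximal S).isPrime.radical_le_iff.2 ?_
    rw [← hm, ← hI]
    exact Ideal.map_mono Ideal.le_radical
  · rw [← hm, ← hI]
    exact Ideal.map_radical_le _

variable [Module.Flat R S]

/-- A flat local homomorphism `R → S` for which the maximal ideal of `R` generates that of `S`
preserves lengths. -/
theorem length_baseChange (hm : (maximalIdeal R).map (algebraMap R S) = maximalIdeal S)
    {X : Type v} [AddCommGroup X] [Module R X] (hX : IsFiniteLength R X) :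
    Module.length S (S ⊗[R] X) = Module.length R X := by
  have := isLocalHom_of_map_maximalIdeal_eq hm
  have : Module.FaithfullyFlat R S := Module.FaithfullyFlat.of_flat_of_isLocalHom
  induction hX with
  | of_subsingleton => simp [Module.length_eq_zero]
  | @of_simple_quotient M _ _ N hs _ ih =>
    have h1 := Module.length_eq_add_of_exact N.subtype N.mkQ N.injective_subtype
      N.mkQ_surjective (LinearMap.exact_subtype_mkQ N)
    have h2 := Module.length_eq_add_of_exact (N.subtype.baseChange S) (N.mkQ.baseChange S)
      (Module.Flat.lTensor_preserves_injective_linearMap _ N.injective_subtype)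
      (LinearMap.lTensor_surjective S N.mkQ_surjective)
      (lTensor_exact S (LinearMap.exact_subtype_mkQ N) N.mkQ_surjective)
    rw [h1, h2, ih, Module.length_eq_one R (M ⧸ N)]
    congr 1
    -- a generator `x` of the simple module makes `S ⊗ (M / N)` a quotient of `S`
    have := IsSimpleModule.nontrivial R (M ⧸ N)
    obtain ⟨x, hx⟩ := exists_ne (0 : M ⧸ N)
    have hker : maximalIdeal R ≤ LinearMap.ker (LinearMap.toSpanSingleton R (M ⧸ N) x) := by
      have hmax := IsSimpleModule.ker_toSpanSingleton_isMaximal R hx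
      rw [IsLocalRing.eq_maximalIdeal hmax]
    have hsurj := IsSimpleModule.toSpanSingleton_surjective R hx
    refine length_eq_one_of_generator (1 ⊗ₜ x) (fun t => ?_) ?_
    · induction t using TensorProduct.induction_on with
      | zero => exact ⟨0, map_zero _⟩
      | tmul s y =>
        obtain ⟨r, rfl⟩ := hsurj y
        refine ⟨r • s, ?_⟩
        change (r • s) • ((1 : S) ⊗ₜ[R] x) = s ⊗ₜ (r • x)
        rw [TensorProduct.smul_tmul', smul_eq_mul, mul_one, TensorProduct.smul_tmul]
      | add a b ha hb =>
        obtain ⟨a', rfl⟩ := ha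
        obtain ⟨b', rfl⟩ := hb
        exact ⟨a' + b', map_add _ _ _⟩
    · rw [← hm, Ideal.map_le_iff_le_comap]
      intro r hr
      have h3 : r • x = 0 := hker hr
      change algebraMap R S r • (1 : S) ⊗ₜ[R] x = 0
      rw [algebraMap_smul, ← TensorProduct.tmul_smul, h3, TensorProduct.tmul_zero]

theorem hsFun_baseChange [IsNoetherianRing R]
    (hm : (maximalIdeal R).map (algebraMap R S) = maximalIdeal S) {I : Ideal R}
    (hI : I.radical = maximalIdeal R)
    (X : Type v) [AddCommGroup X] [Module R X] [Module.Finite R X] (n : ℕ) :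
    hsFun (I.map (algebraMap R S)) (S ⊗[R] X) n = hsFun I X n := by
  have hfl : IsFiniteLength R (X ⧸ (I ^ n • ⊤ : Submodule R X)) := isFiniteLength_quotient hI le_rfl
  have hs : Function.Surjective ((I ^ n • (⊤ : Submodule R X)).mkQ.baseChange S) :=
    LinearMap.lTensor_surjective S (Submodule.mkQ_surjective _)
  have hk : LinearMap.ker ((I ^ n • (⊤ : Submodule R X)).mkQ.baseChange S) =
      (I.map (algebraMap R S)) ^ n • ⊤ := by
    rw [← Ideal.map_pow, ← baseChange_smul_top]
    ext t
    exact (lTensor_exact S (LinearMap.exact_subtype_mkQ (I ^ n • (⊤ : Submodule R X)))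
      (Submodule.mkQ_surjective _)) t
  have e := (Submodule.quotEquivOfEq _ _ hk.symm).trans (LinearMap.quotKerEquivOfSurjective _ hs)
  rw [hsFun, len_congr e, len, length_baseChange hm hfl]
  rfl

theorem DepthGE.baseChange (hm : (maximalIdeal R).map (algebraMap R S) = maximalIdeal S)
    {T : Type u} [AddCommGroup T] [Module R T] {d : ℕ} (h : DepthGE R T d) :
    DepthGE S (S ⊗[R] T) d := by
  obtain ⟨rs, hlen, hr, hreg⟩ := h
  refine ⟨rs.map (algebraMap R S), by simpa using hlen, ?_,
    hreg.of_flat_of_isBaseChange (TensorProduct.isBaseChange R T S)⟩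
  intro r hrs
  obtain ⟨a, ha, rfl⟩ := List.mem_map.1 hrs
  rw [← hm]
  exact Ideal.mem_map_of_mem _ (hr a ha)

end FlatLocal

open Polynomial in
/-- The localization `R(X)` of `R[X]` at the extension of the maximal ideal is a flat local
extension of `R` with infinite residue field in which the maximal ideal of `R` generates the
maximal ideal. -/
theorem exists_flat_infinite_residueField (R : Type u) [CommRing R] [IsLocalRing R]
    [IsNoetherianRing R] : ∃ (S : Type u) (_ : CommRing S) (_ : IsLocalRing S)
    (_ : IsNoetherianRing S) (_ : Algebra R S), Module.Flat R S ∧ Infinite (ResidueField S) ∧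
      (maximalIdeal R).map (algebraMap R S) = maximalIdeal S := by
  let P : Ideal R[X] := (maximalIdeal R).map C
  have hP : P.IsPrime := Ideal.isPrime_map_C_of_isPrime
  let S := Localization.AtPrime P
  have hflat : Module.Flat R[X] S := IsLocalization.flat S P.primeCompl
  have hmap : P.map (algebraMap R[X] S) = maximalIdeal S :=
    Localization.AtPrime.map_eq_maximalIdeal
  refine ⟨S, inferInstance, inferInstance, IsLocalization.isNoetherianRing P.primeCompl S
    inferInstance, inferInstance, Module.Flat.trans R R[X] S, ?_, ?_⟩
  · refine Infinite.of_injective (fun n : ℕ => residue S (algebraMap R[X] S (X ^ n))) ?_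
    intro i j hij
    by_contra hne
    have h1 : algebraMap R[X] S (X ^ i - X ^ j) ∈ maximalIdeal S := by
      rw [← residue_eq_zero_iff, map_sub, map_sub, sub_eq_zero]
      exact hij
    have h2 : (X ^ i - X ^ j : R[X]) ∈ P := by
      by_contra h
      exact h1 (IsLocalization.map_units S (⟨_, h⟩ : P.primeCompl))
    have h3 := (Ideal.mem_map_C_iff.1 h2) i
    rw [coeff_sub, coeff_X_pow, coeff_X_pow, if_pos rfl, if_neg hne, sub_zero] at h3
    exact (IsLocalRing.maximalIdeal.isMaximal R).ne_top ((Ideal.eq_top_iff_one _).2 h3)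
  · rw [IsScalarTower.algebraMap_eq R R[X] S, ← Ideal.map_map]
    exact hmap

section

variable {R : Type u} [CommRing R] [IsLocalRing R] [IsNoetherianRing R] {I : Ideal R}

theorem eventuallyPolynomial_hsFun (hI : I.radical = maximalIdeal R) (X : Type v) [AddCommGroup X]
    [Module R X] [Module.Finite R X] : EventuallyPolynomial (hsFun I X) := by
  obtain ⟨S, _, _, _, _, _, _, hm⟩ := exists_flat_infinite_residueField R
  rw [← funext (hsFun_baseChange (S := S) hm hI X)]
  exact eventuallyPolynomial_hsFun_of_infinite (radical_map_eq hm hI) _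

theorem DepthGE.exists_choose_mul_le (hI : I.radical = maximalIdeal R) {T : Type u}
    [AddCommGroup T] [Module R T] [Module.Finite R T] {d : ℕ} (hT : DepthGE R T d) :
    ∃ n₀ : ℕ, ∀ n, ((n + d).choose d : ℤ) * hsFun I T 1 ≤ hsFun I T (n + n₀) := by
  obtain ⟨S, _, _, _, _, _, _, hm⟩ := exists_flat_infinite_residueField R
  rw [← funext (hsFun_baseChange (S := S) hm hI T)]
  exact (hT.baseChange hm).exists_choose_mul_le_of_infinite (radical_map_eq hm hI)

end

end CUlrich

/-! ### The degree of the Hilbert-Samuel function -/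

namespace CUlrich

open IsLocalRing Filter Topology
open scoped Pointwise

theorem smul_top_eq_range_lsmul {R : Type u} [CommRing R] (x : R) (X : Type v)
    [AddCommGroup X] [Module R X] :
    x • (⊤ : Submodule R X) = LinearMap.range (LinearMap.lsmul R X x) := by
  rw [← Submodule.map_top]; rfl

theorem hsFun_zero {R : Type u} [CommRing R] (I : Ideal R) (X : Type v) [AddCommGroup X]
    [Module R X] : hsFun I X 0 = 0 := by
  have : Subsingleton (X ⧸ (I ^ 0 • ⊤ : Submodule R X)) := by
    rw [Submodule.Quotient.subsingleton_iff, pow_zero, Ideal.one_eq_top, Submodule.top_smul]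
  rw [hsFun, len, Module.length_eq_zero]
  rfl

theorem le_of_add_one_le {a : WithBot ℕ∞} {d : ℕ} (h : a + 1 ≤ ((d + 1 : ℕ) : WithBot ℕ∞)) :
    a ≤ d := by
  induction a with
  | bot => exact bot_le
  | coe a =>
    have h1 : a + 1 ≤ ((d + 1 : ℕ) : ℕ∞) := by exact_mod_cast h
    rw [Nat.cast_add, Nat.cast_one, ENat.add_le_add_iff_right ENat.one_ne_top] at h1
    exact_mod_cast h1

section Dimension

variable {R : Type u} [CommRing R]

theorem ringKrullDim_quotient_eq_coheight (p : PrimeSpectrum R) :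
    ringKrullDim (R ⧸ p.asIdeal) = (Order.coheight p : WithBot ℕ∞) := by
  rw [ringKrullDim_quotient, Order.coheight_eq_krullDim_Ici]
  rfl

theorem ringKrullDim_quotient_le_supportDim {X : Type v} [AddCommGroup X] [Module R X]
    {p : PrimeSpectrum R} (hp : p ∈ Module.support R X) :
    ringKrullDim (R ⧸ p.asIdeal) ≤ Module.supportDim R X := by
  rw [ringKrullDim_quotient]
  exact Order.krullDim_le_of_strictMono (fun q => ⟨q.1, Module.mem_support_mono q.2 hp⟩)
    (fun _ _ h => h)

theorem exists_mem_support_ringKrullDim_eq {X : Type v} [AddCommGroup X] [Module R X] {d : ℕ}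
    (h : Module.supportDim R X = d) :
    ∃ p ∈ Module.support R X, ringKrullDim (R ⧸ p.asIdeal) = d := by
  obtain ⟨l, hl⟩ := Order.le_krullDim_iff.1 h.ge
  refine ⟨l.head.1, l.head.2, le_antisymm (h ▸ ringKrullDim_quotient_le_supportDim l.head.2) ?_⟩
  rw [ringKrullDim_quotient_eq_coheight]
  have h1 := Order.length_le_coheight_head (p := l.map Subtype.val (fun _ _ h => h))
  have h2 : ((l.length : ℕ) : ℕ∞) ≤ Order.coheight (l.head : PrimeSpectrum R) := h1
  rw [hl] at h2
  exact_mod_cast h2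

/-- A point of the support of maximal dimension is an associated prime. -/
theorem mem_Ass_of_mem_support [IsNoetherianRing R] {X : Type v} [AddCommGroup X] [Module R X]
    [Module.Finite R X] {d : ℕ} (h : Module.supportDim R X ≤ d) {p : PrimeSpectrum R}
    (hp : p ∈ Module.support R X) (hpd : ringKrullDim (R ⧸ p.asIdeal) = d) :
    p.asIdeal ∈ associatedPrimes R X := by
  apply Module.associatedPrimes.minimalPrimes_annihilator_subset_associatedPrimes
  refine ⟨⟨p.2, Module.annihilator_le_of_mem_support hp⟩, ?_⟩
  rintro q ⟨hq, hqX⟩ hqp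
  by_contra hlt
  let q' : PrimeSpectrum R := ⟨q, hq⟩
  have h1 : q' < p := lt_of_le_not_ge hqp hlt
  have h2 : q' ∈ Module.support R X := Module.mem_support_iff_of_finite.2 hqX
  have h3 := (ringKrullDim_quotient_le_supportDim h2).trans h
  rw [ringKrullDim_quotient_eq_coheight] at h3 hpd
  have h4 := Order.coheight_add_one_le h1
  have h5 : Order.coheight q' ≤ (d : ℕ∞) := by exact_mod_cast h3
  have h6 : Order.coheight p = (d : ℕ∞) := by exact_mod_cast hpd
  rw [h6] at h4
  have h7 := h4.trans h5
  have h8 : d + 1 ≤ d := by exact_mod_cast h7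
  omega

end Dimension

variable {R : Type u} [CommRing R] [IsLocalRing R] [IsNoetherianRing R] {I : Ideal R}

/-- Multiplication by `x ∈ I` induces `Y / I ^ n Y → Y / I ^ (n + 1) Y`, with cokernel the
corresponding quotient of `Y / x Y`. -/
theorem hsFun_succ_le (hI : I.radical = maximalIdeal R) {x : R} (hx : x ∈ I) (Y : Type v)
    [AddCommGroup Y] [Module R Y] [Module.Finite R Y] (n : ℕ) :
    hsFun I Y (n + 1) ≤ hsFun I Y n + hsFun I (QuotSMulTop x Y) (n + 1) := by
  have h1 : hsFun I Y (n + 1) = _ := len_quotient_eq (LinearMap.lsmul R Y x) (I ^ (n + 1) • ⊤)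
    (isFiniteLength_quotient hI le_rfl)
  rw [h1, hsFun_congr I (Submodule.quotEquivOfEq _ _ (smul_top_eq_range_lsmul x Y)),
    hsFun_quotient]
  gcongr
  refine len_quotient_le ?_ (isFiniteLength_quotient hI le_rfl)
  intro y hy
  rw [Submodule.mem_comap, pow_succ', ← smul_eq_mul, Submodule.smul_assoc]
  exact Submodule.smul_mem_smul hx hy

/-- The Hilbert-Samuel function of a module of dimension at most `d` grows at most like `n ^ d`. -/
theorem exists_hsFun_le (hI : I.radical = maximalIdeal R) {d : ℕ} : ∀ {X : Type u}
    [AddCommGroup X] [Module R X] [Module.Finite R X], Module.supportDim R X ≤ d →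
    ∃ C : ℝ, ∀ n, (hsFun I X n : ℝ) ≤ C * ((n : ℝ) + 1) ^ d := by
  induction d with
  | zero =>
    intro X _ _ _ hX
    have hfl : IsFiniteLength R X := by
      apply isFiniteLength_of_support_subset
      intro p hp
      have h1 := (ringKrullDim_quotient_le_supportDim hp).trans hX
      rw [ringKrullDim_quotient_eq_coheight] at h1
      have h2 : Order.coheight p ≤ 0 := by exact_mod_cast h1
      have h3 : IsMax p := Order.coheight_eq_zero.1 (le_antisymm h2 zero_le)
      exact h3.eq_of_le le_top
    refine ⟨len R X, fun n => ?_⟩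
    rw [pow_zero, mul_one]
    exact_mod_cast len_le_of_surjective hfl (Submodule.mkQ _) (Submodule.mkQ_surjective _)
  | succ d ih =>
    intro X _ _ hX hdim
    induction hX using IsNoetherianRing.induction_on_isQuotientEquivQuotientPrime R with
    | subsingleton N =>
      refine ⟨0, fun n => ?_⟩
      rw [hsFun, len, Module.length_eq_zero]
      simp
    | quotient N p e =>
      by_cases hIp : I ≤ p.asIdeal
      · have hp : p = closedPoint R := by
          have h1 : I.radical ≤ p.asIdeal := p.2.radical_le_iff.2 hIp
          rw [hI] at h1
          ext1
          exact ((IsLocalRing.maximalIdeal.isMaximal R).eq_of_le p.2.ne_top h1).symm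
        have hfl : IsFiniteLength R N := by
          apply isFiniteLength_of_support_subset
          intro q hq
          rw [e.support_eq, Module.mem_support_iff_of_finite, Ideal.annihilator_quotient, hp] at hq
          exact le_antisymm le_top hq
        refine ⟨len R N, fun n => ?_⟩
        have h1 : (hsFun I N n : ℝ) ≤ len R N := by
          exact_mod_cast len_le_of_surjective hfl (Submodule.mkQ _) (Submodule.mkQ_surjective _)
        have h2 : (0 : ℝ) ≤ len R N := by exact_mod_cast len_nonneg _
        have h3 : (1 : ℝ) ≤ ((n : ℝ) + 1) ^ (d + 1) :=
          one_le_pow₀ (by linarith [n.cast_nonneg (α := ℝ)])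
        nlinarith
      · obtain ⟨x, hxI, hxp⟩ := SetLike.not_le_iff_exists.1 hIp
        have hxm : x ∈ maximalIdeal R := hI ▸ Ideal.le_radical hxI
        have hreg : IsSMulRegular N x := by
          apply isSMulRegular_of_forall_associatedPrimes
          intro P hP
          rw [LinearEquiv.AssociatedPrimes.eq e,
            associatedPrimes.eq_singleton_of_isPrimary p.2.isPrimary, Set.mem_singleton_iff,
            p.2.radical] at hP
          rwa [hP]
        have hdim' : Module.supportDim R (QuotSMulTop x N) ≤ d := by
          have h1 := Module.supportDim_quotSMulTop_succ_eq_supportDim hreg hxm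
          rw [← h1] at hdim
          exact le_of_add_one_le hdim
        obtain ⟨C, hC⟩ := ih hdim'
        refine ⟨C, fun n => ?_⟩
        have hC0 : 0 ≤ C := by
          have := hC 0
          rw [hsFun_zero] at this
          simpa using this
        induction n with
        | zero => rw [hsFun_zero]; simpa using hC0
        | succ n ihn =>
          have h1 : (hsFun I N (n + 1) : ℝ) ≤ hsFun I N n + hsFun I (QuotSMulTop x N) (n + 1) := by
            exact_mod_cast hsFun_succ_le hI hxI N n
          have h2 := hC (n + 1)
          have h3 : C * ((n : ℝ) + 1) ^ (d + 1) ≤ C * (((n : ℝ) + 1) * ((n : ℝ) + 1 + 1) ^ d) := by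
            rw [pow_succ']
            gcongr
            linarith
          push_cast at h2 ⊢
          rw [pow_succ _ d]
          nlinarith
    | exact N₁ N₂ N₃ f g hf hg hfg h₁ h₃ =>
      obtain ⟨C₁, hC₁⟩ := h₁ ((Module.supportDim_le_of_injective f hf).trans hdim)
      obtain ⟨C₃, hC₃⟩ := h₃ ((Module.supportDim_le_of_surjective g hg).trans hdim)
      refine ⟨C₁ + C₃, fun n => ?_⟩
      have h1 := hsFun_of_exact hI f g hg hfg n
      have h2 := len_quotient_le (smul_top_le_comap (I ^ n) f)
        (isFiniteLength_quotient hI (n := n) le_rfl)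
      have h3 : hsFun I N₂ n ≤ hsFun I N₁ n + hsFun I N₃ n := by rw [h1]; gcongr; exact h2
      have h4 : (hsFun I N₂ n : ℝ) ≤ hsFun I N₁ n + hsFun I N₃ n := by exact_mod_cast h3
      rw [add_mul]
      linarith [hC₁ n, hC₃ n]

end CUlrich

/-! ### Multiplicities -/

namespace CUlrich

open IsLocalRing Filter Topology
open scoped Pointwise

open Classical in
/-- The multiplicity of `X` in dimension `d`: the eventual value of the `d`-th difference of the
Hilbert-Samuel function. It is meaningful for `dim X ≤ d`, and `0` if `dim X < d`. -/
noncomputable def mult {R : Type u} [CommRing R] (I : Ideal R) (d : ℕ) (X : Type v)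
    [AddCommGroup X] [Module R X] : ℤ :=
  if h : ∃ e : ℤ, ∀ᶠ n in atTop, (fwdDiff 1)^[d] (hsFun I X) n = e then h.choose else 0

theorem mult_congr {R : Type u} [CommRing R] (I : Ideal R) (d : ℕ) {X Y : Type*}
    [AddCommGroup X] [Module R X] [AddCommGroup Y] [Module R Y] (e : X ≃ₗ[R] Y) :
    mult I d X = mult I d Y := by
  rw [mult, mult, funext (hsFun_congr I e)]

variable {R : Type u} [CommRing R] [IsLocalRing R] [IsNoetherianRing R] {I : Ideal R}

theorem eventually_eq_mult (hI : I.radical = maximalIdeal R) {d : ℕ} {X : Type u}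
    [AddCommGroup X] [Module R X] [Module.Finite R X] (hX : Module.supportDim R X ≤ d) :
    ∀ᶠ n in atTop, (fwdDiff 1)^[d] (hsFun I X) n = mult I d X := by
  obtain ⟨D, hD⟩ := eventuallyPolynomial_hsFun hI X
  obtain ⟨C, hC⟩ := exists_hsFun_le hI hX
  have h := exists_fwdDiff_iter_eq_of_le hD (hsFun_nonneg I X) hC
  rw [mult, dif_pos h]
  exact h.choose_spec

theorem tendsto_hsFun (hI : I.radical = maximalIdeal R) {d : ℕ} {X : Type u}
    [AddCommGroup X] [Module R X] [Module.Finite R X] (hX : Module.supportDim R X ≤ d) :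
    Tendsto (fun n : ℕ => (hsFun I X n : ℝ) / (n : ℝ) ^ d) atTop
      (𝓝 ((mult I d X : ℝ) / d.factorial)) :=
  tendsto_div_pow_of_fwdDiff_iter_eq (eventually_eq_mult hI hX)

theorem mult_eq_of_tendsto (hI : I.radical = maximalIdeal R) {d : ℕ} {X : Type u}
    [AddCommGroup X] [Module R X] [Module.Finite R X] (hX : Module.supportDim R X ≤ d) {a : ℝ}
    (h : Tendsto (fun n : ℕ => (hsFun I X n : ℝ) / (n : ℝ) ^ d) atTop (𝓝 (a / d.factorial))) :
    (mult I d X : ℝ) = a := by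
  have h1 := tendsto_nhds_unique (tendsto_hsFun hI hX) h
  have h2 : (d.factorial : ℝ) ≠ 0 := by positivity
  field_simp at h1
  exact h1

theorem mult_nonneg (hI : I.radical = maximalIdeal R) {d : ℕ} {X : Type u}
    [AddCommGroup X] [Module R X] [Module.Finite R X] (hX : Module.supportDim R X ≤ d) :
    0 ≤ mult I d X := by
  have h1 : (0 : ℝ) ≤ (mult I d X : ℝ) / d.factorial :=
    ge_of_tendsto' (tendsto_hsFun hI hX) fun n => by
      have : (0 : ℝ) ≤ hsFun I X n := by exact_mod_cast hsFun_nonneg I X n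
      positivity
  have h2 : (0 : ℝ) < d.factorial := by positivity
  have h3 := mul_nonneg h1 h2.le
  rw [div_mul_cancel₀ _ h2.ne'] at h3
  exact_mod_cast h3

theorem mult_of_subsingleton (hI : I.radical = maximalIdeal R) (d : ℕ) (X : Type u)
    [AddCommGroup X] [Module R X] [Subsingleton X] : mult I d X = 0 := by
  have h : Module.supportDim R X ≤ d := by
    rw [Module.supportDim_eq_bot_of_subsingleton]; exact bot_le
  have := mult_eq_of_tendsto hI (d := d) (X := X) h (a := 0) (by
    rw [zero_div]
    refine tendsto_const_nhds.congr fun n => ?_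
    rw [hsFun, len, Module.length_eq_zero]
    simp)
  exact_mod_cast this

/-- The leading terms of Hilbert-Samuel functions are additive in short exact sequences: by
Artin-Rees the filtration induced on the submodule agrees with its adic filtration up to a shift. -/
theorem tendsto_hsFun_of_exact (hI : I.radical = maximalIdeal R) (d : ℕ) {X Y Z : Type u}
    [AddCommGroup X] [Module R X] [Module.Finite R X] [AddCommGroup Y] [Module R Y]
    [Module.Finite R Y] [AddCommGroup Z] [Module R Z]
    (f : X →ₗ[R] Y) (g : Y →ₗ[R] Z) (hf : Function.Injective f) (hg : Function.Surjective g)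
    (H : Function.Exact f g) {α β : ℝ}
    (hα : Tendsto (fun n : ℕ => (hsFun I X n : ℝ) / (n : ℝ) ^ d) atTop (𝓝 α))
    (hβ : Tendsto (fun n : ℕ => (hsFun I Z n : ℝ) / (n : ℝ) ^ d) atTop (𝓝 β)) :
    Tendsto (fun n : ℕ => (hsFun I Y n : ℝ) / (n : ℝ) ^ d) atTop (𝓝 (α + β)) := by
  obtain ⟨k, hk⟩ := exists_comap_smul_top_le I f hf
  let a : ℕ → ℤ := fun n => len R (X ⧸ (I ^ n • (⊤ : Submodule R Y)).comap f)
  have ha1 : ∀ n, a n ≤ hsFun I X n := fun n =>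
    len_quotient_le (smul_top_le_comap (I ^ n) f) (isFiniteLength_quotient hI (n := n) le_rfl)
  have ha2 : ∀ n, hsFun I X n ≤ a (n + k) := fun n =>
    len_quotient_le (hk n)
      (isFiniteLength_quotient hI (n := n + k) (smul_top_le_comap (I ^ (n + k)) f))
  have ha : Tendsto (fun n : ℕ => (a n : ℝ) / (n : ℝ) ^ d) atTop (𝓝 α) := by
    rw [← tendsto_add_atTop_iff_nat k]
    have hup := (tendsto_add_atTop_iff_nat k).2 hα
    have hlow := hα.mul (tendsto_shift_div_pow k d)
    rw [mul_one] at hlow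
    refine tendsto_of_tendsto_of_tendsto_of_le_of_le' hlow hup ?_ ?_
    · filter_upwards [eventually_gt_atTop 0] with n hn
      have h0 : (n : ℝ) ^ d ≠ 0 := by positivity
      rw [div_mul_div_cancel₀ h0]
      have : (hsFun I X n : ℝ) ≤ a (n + k) := by exact_mod_cast ha2 n
      gcongr
    · refine Eventually.of_forall fun n => ?_
      have : (a (n + k) : ℝ) ≤ hsFun I X (n + k) := by exact_mod_cast ha1 (n + k)
      change (a (n + k) : ℝ) / ((n + k : ℕ) : ℝ) ^ d ≤
        (hsFun I X (n + k) : ℝ) / ((n + k : ℕ) : ℝ) ^ d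
      gcongr
  refine (ha.add hβ).congr fun n => ?_
  rw [hsFun_of_exact hI f g hg H n, ← add_div]
  push_cast
  rfl

theorem mult_of_exact (hI : I.radical = maximalIdeal R) {d : ℕ} {X Y Z : Type u}
    [AddCommGroup X] [Module R X] [Module.Finite R X] [AddCommGroup Y] [Module R Y]
    [Module.Finite R Y] [AddCommGroup Z] [Module R Z] [Module.Finite R Z]
    (f : X →ₗ[R] Y) (g : Y →ₗ[R] Z) (hf : Function.Injective f) (hg : Function.Surjective g)
    (H : Function.Exact f g) (hY : Module.supportDim R Y ≤ d) :
    mult I d Y = mult I d X + mult I d Z := by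
  have h := mult_eq_of_tendsto hI hY (a := mult I d X + mult I d Z) (by
    rw [add_div]
    exact tendsto_hsFun_of_exact hI d f g hf hg H
      (tendsto_hsFun hI ((Module.supportDim_le_of_injective f hf).trans hY))
      (tendsto_hsFun hI ((Module.supportDim_le_of_surjective g hg).trans hY)))
  exact_mod_cast h

theorem mult_le_of_surjective (hI : I.radical = maximalIdeal R) {d : ℕ} {Y Z : Type u}
    [AddCommGroup Y] [Module R Y]
    [Module.Finite R Y] [AddCommGroup Z] [Module R Z] [Module.Finite R Z]
    (g : Y →ₗ[R] Z) (hg : Function.Surjective g) (hY : Module.supportDim R Y ≤ d) :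
    mult I d Z ≤ mult I d Y := by
  rw [mult_of_exact hI (LinearMap.ker g).subtype g (Submodule.injective_subtype _) hg
    (LinearMap.exact_subtype_ker_map g) hY]
  have := mult_nonneg hI (I := I) ((Module.supportDim_le_of_injective (LinearMap.ker g).subtype
    (Submodule.injective_subtype _)).trans hY)
  linarith

theorem mult_le_of_injective (hI : I.radical = maximalIdeal R) {d : ℕ} {X Y : Type u}
    [AddCommGroup X] [Module R X] [Module.Finite R X] [AddCommGroup Y] [Module R Y]
    [Module.Finite R Y] (f : X →ₗ[R] Y) (hf : Function.Injective f)
    (hY : Module.supportDim R Y ≤ d) : mult I d X ≤ mult I d Y := by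
  rw [mult_of_exact hI f (LinearMap.range f).mkQ hf (Submodule.mkQ_surjective _)
    (LinearMap.exact_map_mkQ_range f) hY]
  have := mult_nonneg hI (I := I) ((Module.supportDim_le_of_surjective (LinearMap.range f).mkQ
    (Submodule.mkQ_surjective _)).trans hY)
  linarith

/-- In dimension less than `d` the difference of order `d - 1` is already eventually constant. -/
theorem mult_eq_zero_of_supportDim_lt (hI : I.radical = maximalIdeal R) {d : ℕ} {X : Type u}
    [AddCommGroup X] [Module R X] [Module.Finite R X] (hX : Module.supportDim R X < d) :
    mult I d X = 0 := by
  rcases subsingleton_or_nontrivial X with h | h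
  · exact mult_of_subsingleton hI d X
  obtain ⟨d, rfl⟩ : ∃ d', d = d' + 1 := by
    rcases d with - | d
    · exact absurd (Module.supportDim_ne_bot_of_nontrivial R X) (by
        rw [not_not]
        exact (WithBot.lt_coe_bot.1 hX))
    · exact ⟨d, rfl⟩
  have h1 : Module.supportDim R X ≤ d := by
    generalize Module.supportDim R X = a at hX
    induction a with
    | bot => exact bot_le
    | coe a =>
      have h1 : a < (d : ℕ∞) + 1 := by exact_mod_cast hX
      exact_mod_cast ENat.lt_natCast_add_one_iff.1 h1
  have h2 := eventually_eq_mult hI h1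
  have h3 := eventually_eq_mult hI hX.le
  obtain ⟨n, hn⟩ := (h3.and (h2.and ((tendsto_add_atTop_nat 1).eventually h2))).exists
  rw [← hn.1, Function.iterate_succ_apply', fwdDiff, hn.2.1, hn.2.2, sub_self]

theorem mult_quotient_prime_pos (hI : I.radical = maximalIdeal R) {d : ℕ} :
    ∀ {p : PrimeSpectrum R}, ringKrullDim (R ⧸ p.asIdeal) = d → 0 < mult I d (R ⧸ p.asIdeal) := by
  induction d with
  | zero =>
    intro p hp
    have hdim : Module.supportDim R (R ⧸ p.asIdeal) ≤ (0 : ℕ) := by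
      rw [Module.supportDim_quotient_eq_ringKrullDim, hp]
    obtain ⟨n, hn, hn1⟩ := ((eventually_eq_mult hI hdim).and (eventually_ge_atTop 1)).exists
    rw [Function.iterate_zero, id] at hn
    rw [← hn]
    have hne : Nontrivial ((R ⧸ p.asIdeal) ⧸ (I ^ n • (⊤ : Submodule R (R ⧸ p.asIdeal)))) := by
      have : Nontrivial (R ⧸ p.asIdeal) := Ideal.Quotient.nontrivial_iff.2 p.2.ne_top
      rw [Submodule.Quotient.nontrivial_iff]
      intro h
      have h1 : I ^ n ≤ maximalIdeal R :=
        (Ideal.pow_le_self (by omega)).trans (hI ▸ Ideal.le_radical)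
      have h2 : I ^ n ≤ Ideal.jacobson ⊥ := h1.trans (maximalIdeal_le_jacobson _)
      have := Submodule.eq_bot_of_le_smul_of_le_jacobson_bot (I ^ n)
        (⊤ : Submodule R (R ⧸ p.asIdeal)) Module.Finite.fg_top h.ge h2
      exact top_ne_bot this
    exact len_pos (isFiniteLength_quotient hI le_rfl)
  | succ d ih =>
    intro p hp
    have hdim : Module.supportDim R (R ⧸ p.asIdeal) = (d + 1 : ℕ) := by
      rw [Module.supportDim_quotient_eq_ringKrullDim, hp]
    rw [ringKrullDim_quotient_eq_coheight] at hp
    have hp' : Order.coheight p = (d : ℕ∞) + 1 := by exact_mod_cast hp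
    obtain ⟨-, ⟨q, hpq, hq⟩, -⟩ := Order.coheight_eq_coe_add_one_iff.1 hp'
    have hqd : ringKrullDim (R ⧸ q.asIdeal) = d := by
      rw [ringKrullDim_quotient_eq_coheight, hq]; rfl
    obtain ⟨x, hxq, hxp⟩ := SetLike.exists_of_lt (show p.asIdeal < q.asIdeal from hpq)
    have hxm : x ∈ maximalIdeal R := le_maximalIdeal q.2.ne_top hxq
    have hreg : IsSMulRegular (R ⧸ p.asIdeal) x := by
      apply isSMulRegular_of_forall_associatedPrimes
      intro P hP
      rw [associatedPrimes.eq_singleton_of_isPrimary p.2.isPrimary, Set.mem_singleton_iff,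
        p.2.radical] at hP
      rwa [hP]
    have hX' : Module.supportDim R (QuotSMulTop x (R ⧸ p.asIdeal)) ≤ d := by
      have h1 := Module.supportDim_quotSMulTop_succ_eq_supportDim hreg hxm
      exact le_of_add_one_le (h1.trans hdim).le
    -- `R / q` is a quotient of `X' = R / (p + x R)`, so `X'` has positive multiplicity
    have hpos : 0 < mult I d (QuotSMulTop x (R ⧸ p.asIdeal)) := by
      refine (ih hqd).trans_le (mult_le_of_surjective hI
        (Submodule.liftQ _ (Submodule.factor (show p.asIdeal ≤ q.asIdeal from hpq.le)) ?_) ?_ hX')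
      · rintro _ ⟨t, -, rfl⟩
        obtain ⟨t, rfl⟩ := Submodule.mkQ_surjective _ t
        change Submodule.Quotient.mk (x • t) = (0 : R ⧸ q.asIdeal)
        rw [Submodule.Quotient.mk_eq_zero]
        exact Ideal.mul_mem_right _ _ hxq
      · intro t
        obtain ⟨t, rfl⟩ := Submodule.mkQ_surjective _ t
        exact ⟨Submodule.Quotient.mk (Submodule.Quotient.mk t), rfl⟩
    refine lt_of_le_of_ne (mult_nonneg hI hdim.le) fun h0 => ?_
    -- otherwise the Hilbert-Samuel function of `R / p` has degree at most `d`, and additivity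
    -- along multiplication by `x` gives a contradiction
    have h1 := eventually_eq_mult hI hdim.le
    rw [← h0] at h1
    obtain ⟨e, he⟩ := exists_eventually_fwdDiff_iter_eq h1
    have h2 := tendsto_div_pow_of_fwdDiff_iter_eq he
    have h3 := tendsto_hsFun_of_exact hI d (LinearMap.lsmul R (R ⧸ p.asIdeal) x)
      (x • (⊤ : Submodule R (R ⧸ p.asIdeal))).mkQ hreg (Submodule.mkQ_surjective _) (by
        rw [LinearMap.exact_iff, Submodule.ker_mkQ, smul_top_eq_range_lsmul]) h2
      (tendsto_hsFun hI hX')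
    have h4 := tendsto_nhds_unique h2 h3
    rw [left_eq_add, div_eq_zero_iff] at h4
    have h5 : (d.factorial : ℝ) ≠ 0 := by positivity
    have h6 : mult I d (QuotSMulTop x (R ⧸ p.asIdeal)) = 0 := by exact_mod_cast h4.resolve_right h5
    omega

theorem mult_pos_of_mem_support (hI : I.radical = maximalIdeal R) {d : ℕ} {X : Type u}
    [AddCommGroup X] [Module R X] [Module.Finite R X] (hX : Module.supportDim R X ≤ d)
    {p : PrimeSpectrum R} (hp : p ∈ Module.support R X)
    (hpd : ringKrullDim (R ⧸ p.asIdeal) = d) : 0 < mult I d X := by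
  obtain ⟨-, f, hf⟩ := (isAssociatedPrime_iff_exists_injective_linearMap _ _).1
    (mem_Ass_of_mem_support hX hp hpd)
  exact (mult_quotient_prime_pos hI hpd).trans_le (mult_le_of_injective hI f hf hX)

theorem mult_pos (hI : I.radical = maximalIdeal R) {d : ℕ} {X : Type u}
    [AddCommGroup X] [Module R X] [Module.Finite R X] (hX : Module.supportDim R X = d) :
    0 < mult I d X := by
  obtain ⟨p, hp, hpd⟩ := exists_mem_support_ringKrullDim_eq hX
  exact mult_pos_of_mem_support hI hX.le hp hpd

theorem hilbertSamuelMult_eq_mult (hI : I.radical = maximalIdeal R) {d : ℕ} {X : Type u}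
    [AddCommGroup X] [Module R X] [Module.Finite R X] (hX : Module.supportDim R X = d) :
    hilbertSamuelMult I X = mult I d X := by
  have hne : ¬ Subsingleton X := by
    rw [← Module.supportDim_eq_bot_iff_subsingleton R, hX]
    exact WithBot.coe_ne_bot
  have hd : dimNat R X = d := by
    rw [dimNat, hX]; rfl
  rw [hilbertSamuelMult, if_neg hne, hd]
  simp_rw [lengthReal_eq]
  have hlim := (tendsto_hsFun hI hX.le).limUnder_eq
  simp only [hsFun] at hlim
  rw [hlim]
  have h2 : (d.factorial : ℝ) ≠ 0 := by positivity
  field_simp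

/-- For a Cohen-Macaulay module `T`, `ℓ(T / I T) ≤ e(I, T)`. -/
theorem len_le_mult_of_isCohenMacaulay (hI : I.radical = maximalIdeal R) {d : ℕ} {T : Type u}
    [AddCommGroup T] [Module R T] [Module.Finite R T] (hT : Module.supportDim R T = d)
    (hCM : IsCohenMacaulay R T) : hsFun I T 1 ≤ mult I d T := by
  have hne : ¬ Subsingleton T := by
    rw [← Module.supportDim_eq_bot_iff_subsingleton R, hT]
    exact WithBot.coe_ne_bot
  have hdepth : DepthGE R T d := by
    have h1 := hCM.resolve_left hne
    rw [hT] at h1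
    have h2 : depth R T = (d : ℕ∞) := by exact_mod_cast h1
    rcases d with - | d
    · exact ⟨[], rfl, by simp, RingTheory.Sequence.IsWeaklyRegular.nil R T⟩
    · have h3 : (d : ℕ∞) < depth R T := by rw [h2]; exact_mod_cast Nat.lt_succ_self d
      rw [depth, lt_iSup_iff] at h3
      obtain ⟨rs, h3⟩ := h3
      rw [lt_iSup_iff] at h3
      obtain ⟨⟨hm, hreg⟩, h3⟩ := h3
      have h4 : d + 1 ≤ rs.length := by exact_mod_cast h3
      refine ⟨rs.take (d + 1), by simpa using h4, fun r hr => hm r (List.mem_of_mem_take hr), ?_⟩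
      have h5 := hreg.toIsWeaklyRegular
      rw [← List.take_append_drop (d + 1) rs, RingTheory.Sequence.isWeaklyRegular_append_iff] at h5
      exact h5.1
  obtain ⟨n₀, hn₀⟩ := hdepth.exists_choose_mul_le hI
  have h1 : Tendsto (fun n : ℕ => ((n.choose d : ℝ) / (n : ℝ) ^ d * hsFun I T 1) *
      ((n : ℝ) ^ d / ((n + n₀ : ℕ) : ℝ) ^ d)) atTop
      (𝓝 (1 / (d.factorial : ℝ) * hsFun I T 1 * 1)) := by
    have := tendsto_choose_div_pow d d le_rfl
    rw [if_pos rfl] at this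
    exact (this.mul_const _).mul (tendsto_shift_div_pow n₀ d)
  have h2 := (tendsto_add_atTop_iff_nat n₀).2 (tendsto_hsFun hI hT.le)
  have h3 : 1 / (d.factorial : ℝ) * hsFun I T 1 * 1 ≤ (mult I d T : ℝ) / d.factorial := by
    refine le_of_tendsto_of_tendsto h1 h2 ?_
    filter_upwards [eventually_gt_atTop 0] with n hn
    have h0 : (n : ℝ) ^ d ≠ 0 := by positivity
    have h4 : ((n.choose d : ℕ) : ℤ) * hsFun I T 1 ≤ hsFun I T (n + n₀) := by
      refine le_trans ?_ (hn₀ n)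
      refine mul_le_mul_of_nonneg_right ?_ (hsFun_nonneg I T 1)
      exact_mod_cast Nat.choose_le_choose d (by omega)
    have h5 : (n.choose d : ℝ) * hsFun I T 1 ≤ hsFun I T (n + n₀) := by exact_mod_cast h4
    have h6 : (n.choose d : ℝ) / (n : ℝ) ^ d * hsFun I T 1 * ((n : ℝ) ^ d / ((n + n₀ : ℕ) : ℝ) ^ d)
        = (n.choose d : ℝ) * hsFun I T 1 / ((n + n₀ : ℕ) : ℝ) ^ d := by
      field_simp
    rw [h6]
    gcongr
  have h7 : (0 : ℝ) < d.factorial := by positivity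
  rw [mul_one, one_div, inv_mul_eq_div, div_le_div_iff_of_pos_right h7] at h3
  exact_mod_cast h3

end CUlrich

/-! ### The associativity formula -/

namespace CUlrich

open IsLocalRing Filter Topology

theorem support_tensorProduct {R : Type u} [CommRing R] (M N : Type u) [AddCommGroup M]
    [Module R M] [Module.Finite R M] [AddCommGroup N] [Module R N] [Module.Finite R N] :
    Module.support R (M ⊗[R] N) = Module.support R M ∩ Module.support R N := by
  ext p
  rw [Set.mem_inter_iff, Module.mem_support_iff_nontrivial_residueField_tensorProduct,
    Module.mem_support_iff_nontrivial_residueField_tensorProduct,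
    Module.mem_support_iff_nontrivial_residueField_tensorProduct]
  let κ := p.asIdeal.ResidueField
  have e : κ ⊗[R] (M ⊗[R] N) ≃ₗ[κ] (κ ⊗[R] M) ⊗[κ] (κ ⊗[R] N) :=
    TensorProduct.AlgebraTensorModule.distribBaseChange R κ M N
  rw [e.toEquiv.nontrivial_congr]
  constructor
  · intro h
    constructor
    · by_contra hM
      rw [not_nontrivial_iff_subsingleton] at hM
      exact not_subsingleton ((κ ⊗[R] M) ⊗[κ] (κ ⊗[R] N)) inferInstance
    · by_contra hM
      rw [not_nontrivial_iff_subsingleton] at hM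
      exact not_subsingleton ((κ ⊗[R] M) ⊗[κ] (κ ⊗[R] N)) inferInstance
  · rintro ⟨h1, h2⟩
    infer_instance

/-- If `N_p ≅ R_p ^ r` then `(M ⊗ N)_p ≅ M_p ^ r`. -/
theorem nonempty_localizedModule_tensor_equiv {R : Type u} [CommRing R] (p : Ideal R) [p.IsPrime]
    (M N : Type u) [AddCommGroup M] [Module R M] [AddCommGroup N] [Module R N] {r : ℕ}
    (h : Nonempty (LocalizedModule.AtPrime p N ≃ₗ[Localization.AtPrime p]
      (Fin r → Localization.AtPrime p))) :
    Nonempty (LocalizedModule.AtPrime p (M ⊗[R] N) ≃ₗ[Localization.AtPrime p]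
      (Fin r → LocalizedModule.AtPrime p M)) := by
  obtain ⟨e⟩ := h
  let A := Localization.AtPrime p
  have eN : A ⊗[R] N ≃ₗ[A] (Fin r → A) := (LocalizedModule.equivTensorProduct _ N).symm.trans e
  have e1 : LocalizedModule.AtPrime p (M ⊗[R] N) ≃ₗ[A] A ⊗[R] (M ⊗[R] N) :=
    LocalizedModule.equivTensorProduct _ _
  have e2 : A ⊗[R] (M ⊗[R] N) ≃ₗ[A] (A ⊗[R] M) ⊗[A] (A ⊗[R] N) :=
    TensorProduct.AlgebraTensorModule.distribBaseChange R A M N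
  have e3 : (A ⊗[R] M) ⊗[A] (A ⊗[R] N) ≃ₗ[A] (A ⊗[R] M) ⊗[A] (Fin r → A) :=
    TensorProduct.congr (LinearEquiv.refl _ _) eN
  have e4 : (A ⊗[R] M) ⊗[A] (Fin r → A) ≃ₗ[A] (Fin r → A ⊗[R] M) :=
    TensorProduct.piScalarRight A A (A ⊗[R] M) (Fin r)
  have e5 : (Fin r → A ⊗[R] M) ≃ₗ[A] (Fin r → LocalizedModule.AtPrime p M) :=
    LinearEquiv.piCongrRight fun _ => (LocalizedModule.equivTensorProduct _ M).symm
  exact ⟨e1.trans (e2.trans (e3.trans (e4.trans e5)))⟩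

/-- The localization of `R / q` at `q` is the residue field, of length one. -/
theorem length_localizedModule_quotient_self {R : Type u} [CommRing R] (q : PrimeSpectrum R) :
    Module.length (Localization.AtPrime q.asIdeal)
      (LocalizedModule.AtPrime q.asIdeal (R ⧸ q.asIdeal)) = 1 := by
  have : Nontrivial (LocalizedModule.AtPrime q.asIdeal (R ⧸ q.asIdeal)) := by
    rw [← Module.mem_support_iff, Module.mem_support_iff_of_finite, Ideal.annihilator_quotient]
  refine length_eq_one_of_generator (LocalizedModule.mk 1 1) ?_ ?_
  · intro t
    induction t using LocalizedModule.induction_on with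
    | h m s =>
      obtain ⟨a, rfl⟩ := Ideal.Quotient.mk_surjective m
      refine ⟨Localization.mk a s, ?_⟩
      rw [LinearMap.toSpanSingleton_apply, LocalizedModule.mk_smul_mk, mul_one]
      congr 1
      rw [Algebra.smul_def, mul_one]
      rfl
  · rw [← Localization.AtPrime.map_eq_maximalIdeal, Ideal.map_le_iff_le_comap]
    intro a ha
    rw [Ideal.mem_comap, LinearMap.mem_ker, LinearMap.toSpanSingleton_apply,
      ← Localization.mk_one_eq_algebraMap, LocalizedModule.mk_smul_mk]
    have : a • (1 : R ⧸ q.asIdeal) = 0 := by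
      rw [Algebra.smul_def, mul_one]
      exact Ideal.Quotient.eq_zero_iff_mem.2 ha
    rw [this, LocalizedModule.zero_mk]

theorem supportDim_tensorProduct_le {R : Type u} [CommRing R] {M N : Type u} [AddCommGroup M]
    [Module R M] [Module.Finite R M] [AddCommGroup N] [Module R N] [Module.Finite R N] :
    Module.supportDim R (M ⊗[R] N) ≤ Module.supportDim R M := by
  refine Order.krullDim_le_of_strictMono (fun q => ⟨q.1, ?_⟩) (fun _ _ h => h)
  have : (q : PrimeSpectrum R) ∈ Module.support R M ∩ Module.support R N := by
    rw [← support_tensorProduct]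
    exact q.2
  exact this.1

variable {R : Type u} [CommRing R] [IsLocalRing R] [IsNoetherianRing R] {I : Ideal R}

/-- The associativity formula: `e(I, X) = ∑ ℓ(X_p) e(I, R / p)`, the sum being over the points of
dimension `d` of the support of `X`, all of which are assumed to belong to the finite set `S`. -/
theorem mult_eq_sum (hI : I.radical = maximalIdeal R) {d : ℕ} {S : Finset (PrimeSpectrum R)}
    (hS : ∀ p ∈ S, ringKrullDim (R ⧸ p.asIdeal) = d) {X : Type u} [AddCommGroup X] [Module R X]
    [hX : Module.Finite R X] : Module.supportDim R X ≤ d →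
    (∀ p ∈ Module.support R X, ringKrullDim (R ⧸ p.asIdeal) = d → p ∈ S) →
    (∀ p ∈ S, IsFiniteLength (Localization.AtPrime p.asIdeal)
      (LocalizedModule.AtPrime p.asIdeal X)) ∧
    mult I d X = ∑ p ∈ S, len (Localization.AtPrime p.asIdeal)
      (LocalizedModule.AtPrime p.asIdeal X) * mult I d (R ⧸ p.asIdeal) := by
  classical
  induction hX using IsNoetherianRing.induction_on_isQuotientEquivQuotientPrime R with
  | subsingleton N =>
    intro _ _
    refine ⟨fun p _ => .of_subsingleton, ?_⟩
    rw [mult_of_subsingleton hI, Finset.sum_eq_zero]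
    intro p _
    rw [len, Module.length_eq_zero]
    simp
  | quotient N q e =>
    intro hdim hSN
    have hsub : ∀ p ∈ S, p ≠ q → Subsingleton (LocalizedModule.AtPrime p.asIdeal N) := by
      intro p hp hpq
      rw [← Module.notMem_support_iff, e.support_eq, Module.mem_support_iff_of_finite,
        Ideal.annihilator_quotient]
      intro hle
      have hlt : q < p := lt_of_le_of_ne hle (Ne.symm hpq)
      have h1 := Order.coheight_add_one_le hlt
      have h2 := hS p hp
      rw [Module.supportDim_eq_of_equiv e, Module.supportDim_quotient_eq_ringKrullDim] at hdim
      rw [ringKrullDim_quotient_eq_coheight] at h2 hdim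
      have h3 : Order.coheight q ≤ (d : ℕ∞) := by exact_mod_cast hdim
      have h4 : Order.coheight p = (d : ℕ∞) := by exact_mod_cast h2
      rw [h4] at h1
      have h5 : d + 1 ≤ d := by exact_mod_cast h1.trans h3
      omega
    have hlen : Module.length (Localization.AtPrime q.asIdeal)
        (LocalizedModule.AtPrime q.asIdeal N) = 1 := by
      rw [← length_localizedModule_quotient_self q]
      exact (LinearEquiv.ofBijective (LocalizedModule.map q.asIdeal.primeCompl e.toLinearMap)
        ⟨LocalizedModule.map_injective _ _ e.injective,
          LocalizedModule.map_surjective _ _ e.surjective⟩).length_eq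
    refine ⟨fun p hp => ?_, ?_⟩
    · by_cases hpq : p = q
      · subst hpq
        rw [← Module.length_ne_top_iff, hlen]
        exact ENat.one_ne_top
      · have := hsub p hp hpq
        exact .of_subsingleton
    · rw [mult_congr I d e]
      have hz : ∀ p ∈ S, p ≠ q → len (Localization.AtPrime p.asIdeal)
          (LocalizedModule.AtPrime p.asIdeal N) * mult I d (R ⧸ p.asIdeal) = 0 := by
        intro p hp hpq
        have := hsub p hp hpq
        rw [len, Module.length_eq_zero]
        simp
      by_cases hq : q ∈ S
      · rw [Finset.sum_eq_single_of_mem q hq hz, len, hlen]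
        simp
      · rw [Finset.sum_eq_zero fun p hp => hz p hp (by rintro rfl; exact hq hp)]
        apply mult_eq_zero_of_supportDim_lt hI
        rw [← Module.supportDim_eq_of_equiv e]
        refine lt_of_le_of_ne hdim fun h => hq (hSN q ?_ ?_)
        · rw [e.support_eq, Module.mem_support_iff_of_finite, Ideal.annihilator_quotient]
        · rw [← Module.supportDim_quotient_eq_ringKrullDim, ← Module.supportDim_eq_of_equiv e, h]
  | exact N₁ N₂ N₃ f g hf hg hfg h₁ h₃ =>
    intro hdim hSN
    rw [Module.support_of_exact hfg hf hg] at hSN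
    obtain ⟨a₁, b₁⟩ := h₁ ((Module.supportDim_le_of_injective f hf).trans hdim)
      fun p hp => hSN p (Or.inl hp)
    obtain ⟨a₃, b₃⟩ := h₃ ((Module.supportDim_le_of_surjective g hg).trans hdim)
      fun p hp => hSN p (Or.inr hp)
    have key : ∀ p : PrimeSpectrum R, _ := fun p =>
      Module.length_eq_add_of_exact (LocalizedModule.map p.asIdeal.primeCompl f)
        (LocalizedModule.map p.asIdeal.primeCompl g)
        (LocalizedModule.map_injective _ f hf) (LocalizedModule.map_surjective _ g hg)
        (LocalizedModule.map_exact _ f g hfg)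
    have hfin : ∀ p ∈ S, IsFiniteLength (Localization.AtPrime p.asIdeal)
      (LocalizedModule.AtPrime p.asIdeal N₂) := by
      intro p hp
      rw [← Module.length_ne_top_iff, key p]
      have a := Module.length_ne_top_iff.2 (a₁ p hp)
      have b := Module.length_ne_top_iff.2 (a₃ p hp)
      exact WithTop.add_ne_top.2 ⟨a, b⟩
    refine ⟨hfin, ?_⟩
    rw [mult_of_exact hI f g hf hg hfg hdim, b₁, b₃, ← Finset.sum_add_distrib]
    refine Finset.sum_congr rfl fun p hp => ?_
    rw [← add_mul, len_of_exact (hfin p hp) (LocalizedModule.map p.asIdeal.primeCompl f)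
        (LocalizedModule.map p.asIdeal.primeCompl g)
        (LocalizedModule.map_injective _ f hf) (LocalizedModule.map_surjective _ g hg)
        (LocalizedModule.map_exact _ f g hfg)]

/-- If `N` has rank `r` on the points of dimension `d` of the support of `X`, then
`e(I, X ⊗ N) = r e(I, X)`. -/
theorem mult_tensorProduct (hI : I.radical = maximalIdeal R) {d : ℕ} {X N : Type u}
    [AddCommGroup X] [Module R X] [Module.Finite R X] [AddCommGroup N] [Module R N]
    [Module.Finite R N] (hX : Module.supportDim R X ≤ d) {r : ℕ}
    (h : ∀ p ∈ Module.support R X, ringKrullDim (R ⧸ p.asIdeal) = d →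
      Nonempty (LocalizedModule.AtPrime p.asIdeal N ≃ₗ[Localization.AtPrime p.asIdeal]
        (Fin r → Localization.AtPrime p.asIdeal))) :
    mult I d (X ⊗[R] N) = r * mult I d X := by
  have hfin : {p : PrimeSpectrum R | p ∈ Module.support R X ∧
      ringKrullDim (R ⧸ p.asIdeal) = d}.Finite := by
    refine ((associatedPrimes.finite R X).preimage
      (f := PrimeSpectrum.asIdeal) (fun a _ b _ hab => PrimeSpectrum.ext hab)).subset ?_
    rintro p ⟨hp, hpd⟩
    exact mem_Ass_of_mem_support hX hp hpd
  have hS : ∀ p ∈ hfin.toFinset, p ∈ Module.support R X ∧ ringKrullDim (R ⧸ p.asIdeal) = d :=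
    fun p hp => hfin.mem_toFinset.1 hp
  rw [(mult_eq_sum hI (fun p hp => (hS p hp).2) hX
      (fun p hp hpd => hfin.mem_toFinset.2 ⟨hp, hpd⟩)).2,
    (mult_eq_sum hI (fun p hp => (hS p hp).2) (supportDim_tensorProduct_le.trans hX)
      (fun p hp hpd => hfin.mem_toFinset.2
        ⟨by rw [support_tensorProduct] at hp; exact hp.1, hpd⟩)).2,
    Finset.mul_sum]
  refine Finset.sum_congr rfl fun p hp => ?_
  obtain ⟨e⟩ := nonempty_localizedModule_tensor_equiv p.asIdeal X N (h p (hS p hp).1 (hS p hp).2)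
  rw [len_congr e, ← mul_assoc]
  congr 1
  rw [len, len, Module.length_pi_of_fintype]
  simp

end CUlrich

/-! ### The first torsion module -/

namespace CUlrich

open CategoryTheory

/-- Comparison of a projective resolution `P₂ → P₁ → P₀ → N` with a presentation `K → F → N`: a
lift `P₁ → K` of the identity of `N` kills `P₂` and, after tensoring with `M`, maps the kernel of
`M ⊗ P₁ → M ⊗ P₀` onto that of `M ⊗ K → M ⊗ F`. Exactness at `P₁` is not needed. -/
theorem exists_surjective_of_presentation {R : Type u} [CommRing R]
    {M N F P₀ P₁ P₂ : Type u} [AddCommGroup M] [Module R M] [AddCommGroup N] [Module R N]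
    [AddCommGroup F] [Module R F] [AddCommGroup P₀] [Module R P₀] [AddCommGroup P₁] [Module R P₁]
    [AddCommGroup P₂] [Module R P₂] [Module.Projective R F] [Module.Projective R P₀]
    {π : F →ₗ[R] N} (hπ : Function.Surjective π) (d₂ : P₂ →ₗ[R] P₁) (d₁ : P₁ →ₗ[R] P₀)
    (ε : P₀ →ₗ[R] N) (hε : Function.Surjective ε) (h₂ : d₁ ∘ₗ d₂ = 0)
    (h₁ : Function.Exact d₁ ε) :
    ∃ b : P₁ →ₗ[R] LinearMap.ker π, b ∘ₗ d₂ = 0 ∧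
      (∀ y, d₁.lTensor M y = 0 → (LinearMap.ker π).subtype.lTensor M (b.lTensor M y) = 0) ∧
      ∀ x, (LinearMap.ker π).subtype.lTensor M x = 0 →
        ∃ y, d₁.lTensor M y = 0 ∧ b.lTensor M y = x := by
  obtain ⟨a, ha⟩ := Module.projective_lifting_property ε π hε
  obtain ⟨b₀, hb₀⟩ := Module.projective_lifting_property π ε hπ
  have hεd : ∀ y, ε (d₁ y) = 0 := fun y => (h₁ _).2 ⟨y, rfl⟩
  have ha' : ∀ x, ε (a x) = π x := fun x => LinearMap.congr_fun ha x
  have hb' : ∀ x, π (b₀ x) = ε x := fun x => LinearMap.congr_fun hb₀ x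
  let b : P₁ →ₗ[R] LinearMap.ker π := (b₀ ∘ₗ d₁).codRestrict _ fun y => by
    simp [hb', hεd]
  have hιb : (LinearMap.ker π).subtype ∘ₗ b = b₀ ∘ₗ d₁ := by ext; rfl
  refine ⟨b, ?_, ?_, ?_⟩
  · ext y
    have : d₁ (d₂ y) = 0 := LinearMap.congr_fun h₂ y
    simp [b, this]
  · intro y hy
    rw [← LinearMap.lTensor_comp_apply, hιb, LinearMap.lTensor_comp_apply, hy, map_zero]
  · intro x hx
    let d₁' : P₁ →ₗ[R] LinearMap.ker ε := d₁.codRestrict _ fun y => by simp [hεd]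
    have hd₁' : Function.Surjective d₁' := by
      rintro ⟨z, hz⟩
      obtain ⟨y, hy⟩ := (h₁ z).1 hz
      exact ⟨y, Subtype.ext hy⟩
    let a' : LinearMap.ker π →ₗ[R] LinearMap.ker ε := a.restrict fun z hz => by
      rw [LinearMap.mem_ker] at hz ⊢
      rw [ha', hz]
    let b' : LinearMap.ker ε →ₗ[R] LinearMap.ker π := b₀.restrict fun z hz => by
      rw [LinearMap.mem_ker] at hz ⊢
      rw [hb', hz]
    -- the endomorphism `b₀ a` of `F` lifts the identity of `N`, so it is `1 + θ` with `θ F ⊆ K`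
    let θ : F →ₗ[R] LinearMap.ker π := (b₀ ∘ₗ a - LinearMap.id).codRestrict _ fun z => by
      simp [ha', hb']
    have hba : b' ∘ₗ a' = LinearMap.id + θ ∘ₗ (LinearMap.ker π).subtype := by
      ext z
      simp [b', a', θ, LinearMap.restrict_apply]
    obtain ⟨y, hy⟩ := LinearMap.lTensor_surjective M hd₁' (a'.lTensor M x)
    refine ⟨y, ?_, ?_⟩
    · have e1 : d₁ = (LinearMap.ker ε).subtype ∘ₗ d₁' := by ext; rfl
      have e2 : (LinearMap.ker ε).subtype ∘ₗ a' = a ∘ₗ (LinearMap.ker π).subtype := by ext; rfl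
      rw [e1, LinearMap.lTensor_comp_apply, hy, ← LinearMap.lTensor_comp_apply, e2,
        LinearMap.lTensor_comp_apply, hx, map_zero]
    · have e1 : b = b' ∘ₗ d₁' := by ext; rfl
      rw [e1, LinearMap.lTensor_comp_apply, hy, ← LinearMap.lTensor_comp_apply, hba,
        LinearMap.lTensor_add, LinearMap.add_apply, LinearMap.lTensor_comp_apply, hx, map_zero,
        LinearMap.lTensor_id, add_zero, LinearMap.id_apply]

/-- A surjection from the cycles of a short complex of modules onto `L` that vanishes on the
boundaries induces a surjection from its homology. -/
theorem exists_surjective_homology {R : Type u} [CommRing R] (S : ShortComplex (ModuleCat.{u} R))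
    {L : Type u} [AddCommGroup L] [Module R L] (β : LinearMap.ker S.g.hom →ₗ[R] L)
    (hβ : Function.Surjective β) (h : β ∘ₗ S.moduleCatToCycles = 0) :
    ∃ f : S.homology →ₗ[R] L, Function.Surjective f := by
  let g : S.moduleCatLeftHomologyData.H →ₗ[R] L :=
    (LinearMap.range S.moduleCatToCycles).liftQ β (LinearMap.range_le_ker_iff.2 h)
  have hg : Function.Surjective g := by
    intro x
    obtain ⟨y, rfl⟩ := hβ x
    exact ⟨Submodule.Quotient.mk y, rfl⟩
  exact ⟨g ∘ₗ S.moduleCatHomologyIso.toLinearEquiv.toLinearMap,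
    hg.comp S.moduleCatHomologyIso.toLinearEquiv.surjective⟩

/-- The half of the long exact sequence that is used: for a presentation `0 → K → F → N → 0`
with `F` projective, `Tor₁(M, N)` maps onto `ker (M ⊗ K → M ⊗ F)`. -/
theorem exists_surjective_Tor1 {R : Type u} [CommRing R]
    {M N F : Type u} [AddCommGroup M] [Module R M] [AddCommGroup N] [Module R N]
    [AddCommGroup F] [Module R F] [Module.Projective R F]
    {π : F →ₗ[R] N} (hπ : Function.Surjective π) :
    ∃ f : Tor1 R M N →ₗ[R] LinearMap.ker ((LinearMap.ker π).subtype.lTensor M),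
      Function.Surjective f := by
  let P := projectiveResolution (ModuleCat.of R N)
  let T := (MonoidalCategory.tensoringLeft (ModuleCat.{u} R)).obj (ModuleCat.of R M)
  let C := (T.mapHomologicalComplex _).obj P.complex
  let S := C.sc' 2 1 0
  have e : Tor1 R M N ≅ S.homology :=
    (P.isoLeftDerivedObj T 1) ≪≫ (C.homologyIsoSc' 2 1 0 (by simp) (by simp))
  let ε : P.complex.X 0 ⟶ ModuleCat.of R N := P.π.f 0
  have hε : Function.Surjective ε.hom :=
    (ModuleCat.epi_iff_surjective ε).1 (inferInstanceAs (Epi (P.π.f 0)))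
  have hex : Function.Exact (P.complex.d 1 0).hom ε.hom := by
    have := ShortComplex.exact_of_g_is_cokernel
      (.mk (P.complex.d 1 0) ε P.complex_d_comp_π_f_zero) P.isColimitCokernelCofork
    exact (ShortComplex.ShortExact.moduleCat_exact_iff_function_exact _).1 this
  have : Module.Projective R (P.complex.X 0) :=
    (IsProjective.iff_projective (P.complex.X 0)).2 (P.projective 0)
  have hd : (P.complex.d 1 0).hom ∘ₗ (P.complex.d 2 1).hom = 0 := by
    rw [← ModuleCat.hom_comp, P.complex.d_comp_d, ModuleCat.hom_zero]
  obtain ⟨b, hb₂, hb, hs⟩ := exists_surjective_of_presentation (M := M) hπ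
    (P.complex.d 2 1).hom (P.complex.d 1 0).hom ε.hom hε hd hex
  let β : LinearMap.ker S.g.hom →ₗ[R] LinearMap.ker ((LinearMap.ker π).subtype.lTensor M) :=
    (b.lTensor M).restrict fun y hy => hb y hy
  have hβ : Function.Surjective β := by
    rintro ⟨x, hx⟩
    obtain ⟨y, hy, hyx⟩ := hs x hx
    exact ⟨⟨y, hy⟩, Subtype.ext hyx⟩
  have hβ₂ : β ∘ₗ S.moduleCatToCycles = 0 := by
    have key (z) : b.lTensor M ((P.complex.d 2 1).hom.lTensor M z) = 0 := by
      rw [← LinearMap.lTensor_comp_apply, hb₂, LinearMap.lTensor_zero, LinearMap.zero_apply]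
    exact LinearMap.ext fun z => Subtype.ext (key z)
  obtain ⟨f, hf⟩ := exists_surjective_homology S β hβ hβ₂
  exact ⟨f ∘ₗ e.toLinearEquiv.toLinearMap, hf.comp e.toLinearEquiv.surjective⟩

end CUlrich

/-! ### Presentations and localization -/

namespace CUlrich

open IsLocalRing

/-- A submodule of `M ^ n` whose support avoids `Ass M` vanishes: its annihilator contains an
element regular on `M`. -/
theorem subsingleton_of_forall_notMem_support {R : Type u} [CommRing R] [IsNoetherianRing R]
    {L M : Type u} [AddCommGroup L] [Module R L] [Module.Finite R L] [AddCommGroup M] [Module R M]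
    [Module.Finite R M] {n : ℕ} (f : L →ₗ[R] (Fin n → M)) (hf : Function.Injective f)
    (h : ∀ q ∈ Ass R M, q ∉ Module.support R L) : Subsingleton L := by
  obtain ⟨z, hz, hzM⟩ : ∃ z ∈ Module.annihilator R L, ∀ P ∈ associatedPrimes R M, z ∉ P := by
    by_contra! hcon
    have hsub : (Module.annihilator R L : Set R) ⊆ ⋃ P ∈ associatedPrimes R M, (P : Set R) := by
      intro z hz
      obtain ⟨P, hP, hzP⟩ := hcon z hz
      exact Set.mem_biUnion hP hzP
    obtain ⟨P, hP, hle⟩ := (Ideal.subset_union_prime_finite (associatedPrimes.finite R M)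
      (f := id) ⊥ ⊥ fun P hP _ _ => hP.isPrime).1 hsub
    exact h ⟨P, hP.isPrime⟩ hP (Module.mem_support_iff_of_finite.2 hle)
  have hreg := isSMulRegular_of_forall_associatedPrimes hzM
  refine subsingleton_of_forall_eq 0 fun x => hf ?_
  rw [map_zero]
  ext i
  rw [isSMulRegular_iff_right_eq_zero_of_smul] at hreg
  apply hreg
  rw [← Pi.smul_apply, ← map_smul, Module.mem_annihilator.1 hz x, map_zero, Pi.zero_apply]

/-- When `N / I N` is free over `R / I`, a basis of it lifts to generators of `N`, by Nakayama's
lemma. -/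
theorem exists_presentation {R : Type u} [CommRing R] [IsLocalRing R] {I : Ideal R}
    (hI : I ≠ ⊤) {N : Type u} [AddCommGroup N] [Module R N] [Module.Finite R N]
    (hN : Module.Free (R ⧸ I) (QuotIdeal I N)) :
    ∃ (n : ℕ) (π : (Fin n → R) →ₗ[R] N), Function.Surjective π ∧
      Nonempty (QuotIdeal I N ≃ₗ[R] (Fin n → R ⧸ I)) := by
  have : Nontrivial (R ⧸ I) := Ideal.Quotient.nontrivial_iff.2 hI
  have : Module.Finite (R ⧸ I) (QuotIdeal I N) := Module.Finite.of_restrictScalars_finite R _ _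
  let b := Module.finBasis (R ⧸ I) (QuotIdeal I N)
  choose y hy using fun i => Submodule.Quotient.mk_surjective _ (b i)
  refine ⟨_, Fintype.linearCombination R y, ?_, ⟨b.equivFun.restrictScalars R⟩⟩
  rw [← LinearMap.range_eq_top, Fintype.range_linearCombination]
  refine top_le_iff.1 (Submodule.le_of_le_smul_of_le_jacobson_bot Module.Finite.fg_top
    ((le_maximalIdeal hI).trans (maximalIdeal_le_jacobson _)) ?_)
  rw [sup_comm, (Submodule.map_mkQ_eq_top _ _).1]
  have hb : (I • (⊤ : Submodule R N)).mkQ ∘ y = b := funext hy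
  rw [Submodule.map_span, ← Set.range_comp, hb,
    ← Submodule.restrictScalars_span R (R ⧸ I) Ideal.Quotient.mk_surjective, b.span_eq,
    Submodule.restrictScalars_top]

/-- If `N / I N ≅ (R / I) ^ n`, then `ℓ((M ⊗ N) / I (M ⊗ N)) = n ℓ(M / I M)`. -/
theorem hsFun_tensorProduct_one {R : Type u} [CommRing R] {I : Ideal R} {M N : Type u}
    [AddCommGroup M] [Module R M] [AddCommGroup N] [Module R N] {n : ℕ}
    (e : QuotIdeal I N ≃ₗ[R] (Fin n → R ⧸ I)) :
    hsFun I (M ⊗[R] N) 1 = n * hsFun I M 1 := by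
  have e' : QuotIdeal I (M ⊗[R] N) ≃ₗ[R] (Fin n → QuotIdeal I M) :=
    (TensorProduct.tensorQuotEquivQuotSMul (M ⊗[R] N) I).symm ≪≫ₗ
      TensorProduct.assoc R M N (R ⧸ I) ≪≫ₗ
      TensorProduct.congr (LinearEquiv.refl R M)
        (TensorProduct.tensorQuotEquivQuotSMul N I ≪≫ₗ e) ≪≫ₗ
      TensorProduct.piRight R R M (fun _ : Fin n => R ⧸ I) ≪≫ₗ
      LinearEquiv.piCongrRight fun _ => TensorProduct.tensorQuotEquivQuotSMul M I
  rw [hsFun, hsFun, pow_one, len_congr e', len, len, Module.length_pi_of_fintype]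
  simp

/-- A presentation `R ^ n → N`, localized at a prime where `N` becomes isomorphic to `R_q ^ r`. -/
theorem exists_localized_presentation {R : Type u} [CommRing R] {N : Type u} [AddCommGroup N]
    [Module R N] {n r : ℕ} {π : (Fin n → R) →ₗ[R] N} (hπ : Function.Surjective π)
    {q : PrimeSpectrum R} (h : Nonempty (LocalizedModule.AtPrime q.asIdeal N
      ≃ₗ[Localization.AtPrime q.asIdeal] (Fin r → Localization.AtPrime q.asIdeal))) :
    ∃ φ : (Fin n → Localization.AtPrime q.asIdeal) →ₗ[Localization.AtPrime q.asIdeal]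
        (Fin r → Localization.AtPrime q.asIdeal), Function.Surjective φ ∧
      (Function.Injective φ ↔ q ∉ Module.support R (LinearMap.ker π)) := by
  obtain ⟨e⟩ := h
  let S := q.asIdeal.primeCompl
  let A := Localization.AtPrime q.asIdeal
  let e₀ : LocalizedModule S (Fin n → R) ≃ₗ[A] (Fin n → A) :=
    (LocalizedModule.equivTensorProduct _ _).trans (TensorProduct.piScalarRight R A A (Fin n))
  let ψ := LocalizedModule.map S π
  have hψ : Function.Surjective ψ := LocalizedModule.map_surjective S π hπ
  refine ⟨e.toLinearMap ∘ₗ ψ ∘ₗ e₀.symm.toLinearMap, ?_, ?_⟩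
  · exact e.surjective.comp (hψ.comp e₀.symm.surjective)
  · have h1 : Function.Injective (e.toLinearMap ∘ₗ ψ ∘ₗ e₀.symm.toLinearMap) ↔
        Function.Injective ψ := by
      rw [LinearMap.coe_comp, LinearEquiv.coe_coe, e.injective.of_comp_iff, LinearMap.coe_comp,
        LinearEquiv.coe_coe, Function.Injective.of_comp_iff' _ e₀.symm.bijective]
    have hex : Function.Exact (LocalizedModule.map S (LinearMap.ker π).subtype) ψ :=
      LocalizedModule.map_exact S _ _ π.exact_subtype_ker_map
    have hinj := LocalizedModule.map_injective S (LinearMap.ker π).subtype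
      (Submodule.injective_subtype _)
    rw [h1, Module.notMem_support_iff]
    constructor
    · intro hi
      refine subsingleton_of_forall_eq 0 fun x => hinj ?_
      apply hi
      rw [hex.apply_apply_eq_zero, map_zero, map_zero]
    · intro hs
      rw [injective_iff_map_eq_zero]
      intro x hx
      obtain ⟨y, rfl⟩ := (hex x).1 hx
      rw [Subsingleton.elim y 0, map_zero]

theorem notMem_support_ker_of_le {R : Type u} [CommRing R] {N : Type u} [AddCommGroup N]
    [Module R N] {n r : ℕ} {π : (Fin n → R) →ₗ[R] N} (hπ : Function.Surjective π)
    {q : PrimeSpectrum R} (h : Nonempty (LocalizedModule.AtPrime q.asIdeal N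
      ≃ₗ[Localization.AtPrime q.asIdeal] (Fin r → Localization.AtPrime q.asIdeal)))
    (hnr : n ≤ r) : q ∉ Module.support R (LinearMap.ker π) := by
  obtain ⟨φ, hφ, hiff⟩ := exists_localized_presentation hπ h
  rw [← hiff]
  have hrn : r ≤ n := le_of_fin_surjective _ φ hφ
  obtain rfl := le_antisymm hnr hrn
  exact OrzechProperty.injective_of_surjective_endomorphism φ hφ

theorem le_of_notMem_support_ker {R : Type u} [CommRing R] {N : Type u} [AddCommGroup N]
    [Module R N] {n r : ℕ} {π : (Fin n → R) →ₗ[R] N} (hπ : Function.Surjective π)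
    {q : PrimeSpectrum R} (h : Nonempty (LocalizedModule.AtPrime q.asIdeal N
      ≃ₗ[Localization.AtPrime q.asIdeal] (Fin r → Localization.AtPrime q.asIdeal)))
    (hq : q ∉ Module.support R (LinearMap.ker π)) : n ≤ r := by
  obtain ⟨φ, -, hiff⟩ := exists_localized_presentation hπ h
  exact le_of_fin_injective _ φ (hiff.2 hq)

/-- The associated primes of `R` include a prime below any given one. -/
theorem exists_mem_Ass_le {R : Type u} [CommRing R] [IsNoetherianRing R] (p : PrimeSpectrum R) :
    ∃ q ∈ Ass R R, q ≤ p := by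
  obtain ⟨q, hq, hqp⟩ := Ideal.exists_minimalPrimes_le (I := (⊥ : Ideal R)) (J := p.asIdeal) bot_le
  refine ⟨⟨q, hq.1.1⟩, ?_, hqp⟩
  apply Module.associatedPrimes.minimalPrimes_annihilator_subset_associatedPrimes
  rwa [Module.annihilator_eq_bot.2 inferInstance]

/-- A module of rank `r` that is free at `p` has rank `r` there: ranks of free localizations agree
at a prime and at the associated primes of `R` below it. -/
theorem nonempty_equiv_of_free {R : Type u} [CommRing R] [IsNoetherianRing R] {N : Type u}
    [AddCommGroup N] [Module R N] [Module.Finite R N] {r : ℕ} (hr : HasRank R N r)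
    {p : PrimeSpectrum R} (hp : Module.Free (Localization.AtPrime p.asIdeal)
      (LocalizedModule.AtPrime p.asIdeal N)) :
    Nonempty (LocalizedModule.AtPrime p.asIdeal N ≃ₗ[Localization.AtPrime p.asIdeal]
      (Fin r → Localization.AtPrime p.asIdeal)) := by
  obtain ⟨q, hq, hqp⟩ := exists_mem_Ass_le p
  have : Module.FinitePresentation R N := Module.finitePresentation_of_finite R N
  obtain ⟨e⟩ := hr q hq
  let q' : Module.freeLocus R N := ⟨q, Module.Free.of_equiv e.symm⟩
  let p' : Module.freeLocus R N := ⟨p, hp⟩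
  have hsp : q' ⤳ p' := by
    rw [Topology.IsInducing.subtypeVal.specializes_iff.symm]
    exact (PrimeSpectrum.le_iff_specializes q p).1 hqp
  have heq : Module.rankAtStalk N q = Module.rankAtStalk (R := R) N p :=
    (hsp.map (Module.isLocallyConstant_rankAtStalk_freeLocus (R := R) (M := N)).continuous).eq
  have hqr : Module.rankAtStalk (R := R) N q = r := by
    rw [Module.rankAtStalk, e.finrank_eq, Module.finrank_fin_fun]
  have hfin : Module.finrank (Localization.AtPrime p.asIdeal)
      (LocalizedModule.AtPrime p.asIdeal N) = r := heq.symm.trans hqr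
  exact ⟨(Module.finBasisOfFinrankEq _ _ hfin).equivFun⟩

/-- Every localization of a free module of rank `n` is free of rank `n`. -/
theorem nonempty_localizedModule_pi_equiv {R : Type u} [CommRing R] (n : ℕ) (p : Ideal R)
    [p.IsPrime] : Nonempty (LocalizedModule.AtPrime p (Fin n → R) ≃ₗ[Localization.AtPrime p]
      (Fin n → Localization.AtPrime p)) :=
  ⟨(LocalizedModule.equivTensorProduct _ _).trans
    (TensorProduct.piScalarRight R _ (Localization.AtPrime p) (Fin n))⟩

theorem free_of_subsingleton_ker {R : Type u} [CommRing R] {N : Type u} [AddCommGroup N]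
    [Module R N] {n : ℕ} {π : (Fin n → R) →ₗ[R] N} (hπ : Function.Surjective π)
    (h : Subsingleton (LinearMap.ker π)) : Module.Free R N :=
  Module.Free.of_equiv (LinearEquiv.ofBijective π
    ⟨LinearMap.ker_eq_bot.1 (Submodule.subsingleton_iff_eq_bot.1 h), hπ⟩)

end CUlrich

/-! ### Relations after tensoring -/

namespace CUlrich

open IsLocalRing

theorem free_of_forall_notMem_support {R : Type u} [CommRing R] [IsNoetherianRing R] {N : Type u}
    [AddCommGroup N] [Module R N] {n : ℕ} {π : (Fin n → R) →ₗ[R] N}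
    (hπ : Function.Surjective π) (h : ∀ q ∈ Ass R R, q ∉ Module.support R (LinearMap.ker π)) :
    Module.Free R N :=
  free_of_subsingleton_ker hπ (subsingleton_of_forall_notMem_support
    (LinearMap.ker π).subtype (Submodule.injective_subtype _) h)

theorem free_of_forall_hasRank_of_le {R : Type u} [CommRing R] [IsNoetherianRing R] {N : Type u}
    [AddCommGroup N] [Module R N] {n r : ℕ} {π : (Fin n → R) →ₗ[R] N}
    (hπ : Function.Surjective π) (hr : HasRank R N r) (h : n ≤ r) : Module.Free R N :=
  free_of_forall_notMem_support hπ fun q hq => notMem_support_ker_of_le hπ (hr q hq) h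

/-- Off the support of `Tor₁(M, N)` the relations `M ⊗ K` embed into `M ⊗ R ^ n`; so where in
addition the kernel of `M ⊗ R ^ n → M ⊗ N` vanishes and `M` does not, `K` vanishes. -/
theorem notMem_support_ker_of_notMem_support_Tor1 {R : Type u} [CommRing R] [IsNoetherianRing R]
    {M N : Type u} [AddCommGroup M] [Module R M] [Module.Finite R M] [AddCommGroup N] [Module R N]
    {n : ℕ} {π : (Fin n → R) →ₗ[R] N} (hπ : Function.Surjective π) {p : PrimeSpectrum R}
    (hM : p ∈ Module.support R M) (hT : p ∉ Module.support R (Tor1 R M N))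
    (hL : p ∉ Module.support R (LinearMap.ker (π.lTensor M))) :
    p ∉ Module.support R (LinearMap.ker π) := by
  intro hK
  obtain ⟨f, hf⟩ := exists_surjective_Tor1 (M := M) hπ
  have hex := lTensor_exact M π.exact_subtype_ker_map hπ
  let g : M ⊗[R] LinearMap.ker π →ₗ[R] LinearMap.ker (π.lTensor M) :=
    ((LinearMap.ker π).subtype.lTensor M).codRestrict _ fun x => hex.apply_apply_eq_zero x
  have hg : Function.Surjective g := by
    rintro ⟨z, hz⟩
    obtain ⟨y, hy⟩ := (hex z).1 hz
    exact ⟨y, Subtype.ext hy⟩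
  have hker : Function.Exact (LinearMap.ker ((LinearMap.ker π).subtype.lTensor M)).subtype g := by
    intro x
    rw [← LinearMap.coe_range, Submodule.range_subtype, SetLike.mem_coe, LinearMap.mem_ker]
    exact Subtype.ext_iff
  have hmem : p ∈ Module.support R (M ⊗[R] LinearMap.ker π) := by
    rw [support_tensorProduct]
    exact ⟨hM, hK⟩
  rw [Module.support_of_exact hker (Submodule.injective_subtype _) hg] at hmem
  rcases hmem with h | h
  · exact hT (Module.support_subset_of_surjective f hf h)
  · exact hL h

/-- The support of a torsion module avoids the associated primes of the ring. -/
theorem notMem_support_of_isTorsion {R : Type u} [CommRing R] [IsNoetherianRing R] {X : Type v}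
    [AddCommGroup X] [Module R X] (hX : Module.IsTorsion R X) {q : PrimeSpectrum R}
    (hq : q ∈ Ass R R) : q ∉ Module.support R X := by
  rw [Module.mem_support_iff']
  rintro ⟨m, hm⟩
  obtain ⟨a, ha⟩ := @hX m
  refine hm a (notMem_of_mem_associatedPrimes (T := R) ?_ hq) ha
  rw [isSMulRegular_iff_right_eq_zero_of_smul]
  intro x hx
  exact (mem_nonZeroDivisors_iff.1 a.2).1 x hx

/-- If `M ⊗ R ^ n → M ⊗ N` is injective and `M` is faithful, then `R ^ n → N` is injective, since
the coordinates of every relation kill `M`. -/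
theorem free_of_annihilator_eq_bot {R : Type u} [CommRing R] {M N : Type u} [AddCommGroup M]
    [Module R M] [AddCommGroup N] [Module R N] {n : ℕ} {π : (Fin n → R) →ₗ[R] N}
    (hπ : Function.Surjective π) (hL : Subsingleton (LinearMap.ker (π.lTensor M)))
    (hM : Module.annihilator R M = ⊥) : Module.Free R N := by
  refine free_of_subsingleton_ker hπ (subsingleton_of_forall_eq 0 ?_)
  rintro ⟨k, hk⟩
  refine Subtype.ext (funext fun i => ?_)
  rw [LinearMap.mem_ker] at hk
  change k i = 0
  rw [← Submodule.mem_bot R, ← hM, Module.mem_annihilator]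
  intro m
  have h0 : m ⊗ₜ[R] k = 0 := by
    have hmem : m ⊗ₜ[R] k ∈ LinearMap.ker (π.lTensor M) := by
      rw [LinearMap.mem_ker, LinearMap.lTensor_tmul, hk, TensorProduct.tmul_zero]
    exact congrArg Subtype.val (Subsingleton.elim (⟨_, hmem⟩ : LinearMap.ker (π.lTensor M)) 0)
  have h1 := congrFun (congrArg (TensorProduct.piScalarRight R R M (Fin n)) h0) i
  simpa using h1

theorem support_self (R : Type u) [CommRing R] : Module.support R R = Set.univ := by
  refine Set.eq_univ_of_forall fun p => ?_
  rw [Module.mem_support_iff_of_finite, Module.annihilator_eq_bot.2 inferInstance]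
  exact bot_le

/-- A module of positive rank is supported everywhere. -/
theorem HasRank.support_eq_univ {R : Type u} [CommRing R] [IsNoetherianRing R] {M : Type u}
    [AddCommGroup M] [Module R M] {s : ℕ} (hs : 0 < s) (h : HasRank R M s) :
    Module.support R M = Set.univ := by
  refine Set.eq_univ_of_forall fun p => ?_
  obtain ⟨q, hq, hqp⟩ := exists_mem_Ass_le p
  refine Module.mem_support_mono hqp ?_
  obtain ⟨e⟩ := h q hq
  have : Nonempty (Fin s) := ⟨⟨0, hs⟩⟩
  rw [Module.mem_support_iff]
  exact e.toEquiv.nontrivial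

/-- If the kernel of `M ⊗ R ^ n → M ⊗ N` is not supported at the primes of dimension `dim M` and
`M` is unmixed, then the kernel is zero. -/
theorem subsingleton_ker_lTensor {R : Type u} [CommRing R] [IsNoetherianRing R] {d : ℕ}
    {M N : Type u} [AddCommGroup M] [Module R M] [Module.Finite R M] [AddCommGroup N] [Module R N]
    (hM : Module.supportDim R M = d) {n : ℕ} {π : (Fin n → R) →ₗ[R] N}
    (h : ∀ p : PrimeSpectrum R, ringKrullDim (R ⧸ p.asIdeal) = d →
      p ∉ Module.support R (LinearMap.ker (π.lTensor M))) (hun : IsUnmixed R M) :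
    Subsingleton (LinearMap.ker (π.lTensor M)) := by
  refine subsingleton_of_forall_notMem_support
    ((TensorProduct.piScalarRight R R M (Fin n)).toLinearMap ∘ₗ
      (LinearMap.ker (π.lTensor M)).subtype)
    ((TensorProduct.piScalarRight R R M (Fin n)).injective.comp (Submodule.injective_subtype _))
    fun q hq => h q ?_
  rw [hun] at hq
  rw [hq.2, hM]

variable {R : Type u} [CommRing R] [IsLocalRing R] [IsNoetherianRing R] {I : Ideal R}

theorem mult_ker (hI : I.radical = maximalIdeal R) {d : ℕ} {X Y : Type u}
    [AddCommGroup X] [Module R X] [Module.Finite R X] [AddCommGroup Y] [Module R Y]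
    [Module.Finite R Y] (hX : Module.supportDim R X ≤ d) {f : X →ₗ[R] Y}
    (hf : Function.Surjective f) :
    mult I d (LinearMap.ker f) = mult I d X - mult I d Y :=
  eq_sub_of_add_eq (mult_of_exact hI (LinearMap.ker f).subtype f (Submodule.injective_subtype _)
    hf f.exact_subtype_ker_map hX).symm

theorem mult_tensorProduct_pi (hI : I.radical = maximalIdeal R) {d : ℕ} {M : Type u}
    [AddCommGroup M] [Module R M] [Module.Finite R M] (hM : Module.supportDim R M ≤ d) (n : ℕ) :
    mult I d (M ⊗[R] (Fin n → R)) = n * mult I d M :=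
  mult_tensorProduct hI hM fun p _ _ => nonempty_localizedModule_pi_equiv n p.asIdeal

theorem mult_pi (hI : I.radical = maximalIdeal R) {d : ℕ} (hR : Module.supportDim R R ≤ d)
    (n : ℕ) : mult I d (Fin n → R) = n * mult I d R := by
  rw [← mult_tensorProduct_pi hI hR, mult_congr I d (TensorProduct.lid R (Fin n → R))]

theorem notMem_support_of_mult_nonpos (hI : I.radical = maximalIdeal R) {d : ℕ} {X : Type u}
    [AddCommGroup X] [Module R X] [Module.Finite R X] (hX : Module.supportDim R X ≤ d)
    (h : mult I d X ≤ 0) {p : PrimeSpectrum R} (hpd : ringKrullDim (R ⧸ p.asIdeal) = d) :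
    p ∉ Module.support R X :=
  fun hp => h.not_gt (mult_pos_of_mem_support hI hX hp hpd)

/-- When `M` has positive rank `s`, the modules `M` and `M ⊗ N` have `s` times the multiplicity of
`R` and `N`. -/
theorem mult_of_hasRank (hI : I.radical = maximalIdeal R) {d : ℕ}
    (hR : Module.supportDim R R = d) {M : Type u} [AddCommGroup M] [Module R M]
    [Module.Finite R M] {s : ℕ} (hs : HasRank R M s) {X : Type u} [AddCommGroup X] [Module R X]
    [Module.Finite R X] (hX : Module.supportDim R X ≤ d) :
    mult I d (M ⊗[R] X) = s * mult I d X := by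
  rw [mult_congr I d (TensorProduct.comm R M X)]
  refine mult_tensorProduct hI hX fun p _ hpd => hs p ?_
  exact mem_Ass_of_mem_support hR.le (support_self R ▸ Set.mem_univ p) hpd

theorem sub_one_mul_lt_one {c t : ℝ} (ht : 0 < t) (hc : c < 1 + 1 / t) : (c - 1) * t < 1 := by
  rw [← lt_div_iff₀ ht]
  linarith

theorem le_of_mul_le_of_lt {c l : ℝ} {n r : ℕ} (hl : 0 < l) (h : n * l ≤ r * (c * l))
    (hc : c < 1 + 1 / (r : ℝ)) : n ≤ r := by
  have h1 : (n : ℝ) ≤ r * c := by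
    rw [← mul_assoc] at h
    exact le_of_mul_le_mul_right h hl
  rcases Nat.eq_zero_or_pos r with rfl | hr
  · simpa using h1
  · have hr' : (0 : ℝ) < r := by exact_mod_cast hr
    have h2 := sub_one_mul_lt_one hr' hc
    have h3 : (n : ℝ) < r + 1 := by linarith
    have h4 : n < r + 1 := by exact_mod_cast h3
    omega

end CUlrich

theorem mainTheorem1 {R : Type u} [CommRing R] [IsLocalRing R] [IsNoetherianRing R]
    (I : Ideal R) (hI : I.radical = IsLocalRing.maximalIdeal R)
    {M N : Type u} [AddCommGroup M] [Module R M] [Module.Finite R M] [Nontrivial M]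
    [AddCommGroup N] [Module R N] [Module.Finite R N]
    (hMfree : Module.Free (R ⧸ I) (CUlrich.QuotIdeal I M))
    (hNfree : Module.Free (R ⧸ I) (CUlrich.QuotIdeal I N))
    (hdim : Module.supportDim R M = Module.supportDim R (M ⊗[R] N))
    (hCM : CUlrich.IsCohenMacaulay R (M ⊗[R] N))
    (c : ℝ) (hc : CUlrich.hilbertSamuelMult I M ≤ c * CUlrich.lengthReal R (CUlrich.QuotIdeal I M)) :
    -- in case (ii), the rank of `N` is automatically positive
    (∀ r : ℕ, CUlrich.FreeOn R N (CUlrich.Assh R M) → CUlrich.HasRank R N r → 0 < r) ∧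
    ((
      -- (i)
      ((∃ r : ℕ, CUlrich.HasRank R N r) ∧
        (∃ p ∈ CUlrich.Assh R M,
          Subsingleton (LocalizedModule.AtPrime p.asIdeal (CUlrich.Tor1 R M N))) ∧
        c < 1 + 1 / CUlrich.hilbertSamuelMult I (M ⊗[R] N)) ∨
      -- (ii)
      (CUlrich.FreeOn R N (CUlrich.Assh R M) ∧
        ∃ r : ℕ, CUlrich.HasRank R N r ∧ c < 1 + 1 / (r : ℝ)) ∨
      -- (iii)
      (CUlrich.IsUnmixed R M ∧ c < 1 + 1 / CUlrich.hilbertSamuelMult I (M ⊗[R] N) ∧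
        (Module.annihilator R M = ⊥ ∨
          Subsingleton (CUlrich.Tor1 R M N) ∨
          (Module.IsTorsion R (CUlrich.Tor1 R M N) ∧ Module.support R M = Set.univ))) ∨
      -- (iv)
      ((∃ s : ℕ, 0 < s ∧ CUlrich.HasRank R M s) ∧ CUlrich.IsUnmixed R R ∧
        c < 1 + 1 / CUlrich.hilbertSamuelMult I N) ∨
      -- (v)
      ((∃ s : ℕ, 0 < s ∧ CUlrich.HasRank R M s) ∧ CUlrich.IsUnmixed R R ∧
        ∃ r : ℕ, CUlrich.hilbertSamuelMult I N = r * CUlrich.hilbertSamuelMult I R ∧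
          c < 1 + 1 / (r : ℝ))) →
      Module.Free R N) := by
  open CUlrich in
  have hItop : I ≠ ⊤ := by
    rintro rfl
    rw [Ideal.radical_top] at hI
    exact (Ideal.IsPrime.ne_top inferInstance) hI.symm
  obtain ⟨d, hd⟩ : ∃ d : ℕ, Module.supportDim R M = d := by
    have h1 : Module.supportDim R M ≠ ⊥ := by
      rw [ne_eq, Module.supportDim_eq_bot_iff_subsingleton]
      exact not_subsingleton M
    have h2 : Module.supportDim R M ≠ ⊤ :=
      ((Module.supportDim_le_ringKrullDim R M).trans_lt ringKrullDim_lt_top).ne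
    obtain ⟨a, ha⟩ := WithBot.ne_bot_iff_exists.1 h1
    rw [← ha] at h2 ⊢
    have h3 : a ≠ ⊤ := by
      rintro rfl
      exact h2 rfl
    obtain ⟨b, rfl⟩ := ENat.ne_top_iff_exists.1 h3
    exact ⟨b, rfl⟩
  have hTd : Module.supportDim R (M ⊗[R] N) = d := by rw [← hdim, hd]
  obtain ⟨n, π, hπ, ⟨e⟩⟩ := exists_presentation hItop hNfree
  have hl : (0 : ℝ) < hsFun I M 1 := by
    have : Nontrivial (QuotIdeal I M) := Submodule.Quotient.nontrivial_iff.2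
      (Submodule.top_ne_ideal_smul_of_le_jacobson_annihilator
        ((IsLocalRing.le_maximalIdeal hItop).trans (IsLocalRing.maximalIdeal_le_jacobson _))).symm
    have h := len_pos (isFiniteLength_quotient hI (n := 1) (J := I • (⊤ : Submodule R M))
      (by rw [pow_one]))
    rw [hsFun, pow_one]
    exact_mod_cast h
  -- the length of `T / I T` is bounded by the multiplicity of the Cohen–Macaulay module `T`
  have hnl : (n : ℝ) * hsFun I M 1 ≤ mult I d (M ⊗[R] N) := by
    have h := len_le_mult_of_isCohenMacaulay hI hTd hCM
    rw [hsFun_tensorProduct_one e] at h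
    exact_mod_cast h
  have hMl : (mult I d M : ℝ) ≤ c * hsFun I M 1 := by
    rw [hilbertSamuelMult_eq_mult hI hd, lengthReal_eq] at hc
    rwa [hsFun, pow_one]
  have hc0 : 0 ≤ c := by
    have h : (0 : ℝ) ≤ mult I d M := by exact_mod_cast mult_nonneg hI hd.le
    exact nonneg_of_mul_nonneg_left (h.trans hMl) hl
  have hnM : (n : ℝ) * mult I d M ≤ c * mult I d (M ⊗[R] N) :=
    calc (n : ℝ) * mult I d M ≤ n * (c * hsFun I M 1) := by gcongr
      _ = c * (n * hsFun I M 1) := by ring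
      _ ≤ c * mult I d (M ⊗[R] N) := by gcongr
  have hTpos : (0 : ℝ) < mult I d (M ⊗[R] N) := by exact_mod_cast mult_pos hI hTd
  -- points of `Supp M` of maximal dimension
  have hAssh : ∀ p ∈ Module.support R M, ringKrullDim (R ⧸ p.asIdeal) = d → p ∈ Assh R M :=
    fun p hp hpd => ⟨mem_Ass_of_mem_support hd.le hp hpd, hpd.trans hd.symm⟩
  have hsuppT : Module.support R (M ⊗[R] N) = Module.support R M ∩ Module.support R N :=
    support_tensorProduct M N
  -- if `c` is small, `M ⊗ R ^ n → M ⊗ N` is an isomorphism in maximal dimension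
  have hL : c < 1 + 1 / hilbertSamuelMult I (M ⊗[R] N) → ∀ p : PrimeSpectrum R,
      ringKrullDim (R ⧸ p.asIdeal) = d → p ∉ Module.support R (LinearMap.ker (π.lTensor M)) := by
    intro hcT p hpd
    rw [hilbertSamuelMult_eq_mult hI hTd] at hcT
    have hFd : Module.supportDim R (M ⊗[R] (Fin n → R)) ≤ d :=
      supportDim_tensorProduct_le.trans hd.le
    refine notMem_support_of_mult_nonpos hI ((Module.supportDim_le_of_injective _
      (Submodule.injective_subtype _)).trans hFd) ?_ hpd
    rw [mult_ker hI hFd (LinearMap.lTensor_surjective M hπ), mult_tensorProduct_pi hI hd.le]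
    have h1 := sub_one_mul_lt_one hTpos hcT
    have h2 : ((n * mult I d M - mult I d (M ⊗[R] N) : ℤ) : ℝ) < 1 := by
      push_cast
      linarith
    have h3 : n * mult I d M - mult I d (M ⊗[R] N) < 1 := by exact_mod_cast h2
    omega
  -- when `M` has positive rank, `Supp M = Spec R` and multiplicities compare to those of `R`
  have hRdim : ∀ s, 0 < s → HasRank R M s → Module.supportDim R R = d := by
    intro s hs hMs
    rw [← hd, Module.supportDim, Module.supportDim, hMs.support_eq_univ hs,
      support_self R]
  have hrank : ∀ s, 0 < s → HasRank R M s → Module.supportDim R N = d ∧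
      mult I d M = s * mult I d R ∧ mult I d (M ⊗[R] N) = s * mult I d N := by
    intro s hs hMs
    have hNd : Module.supportDim R N = d := by
      rw [hMs.support_eq_univ hs, Set.univ_inter] at hsuppT
      rw [← hTd, Module.supportDim, Module.supportDim, hsuppT]
    have hRd := hRdim s hs hMs
    refine ⟨hNd, ?_, mult_of_hasRank hI hRd hMs hNd.le⟩
    rw [← mult_of_hasRank hI hRd hMs hRd.le, mult_congr I d (TensorProduct.rid R M)]
  -- when moreover `R` is unmixed, `K` vanishes as soon as `e(K) = n e(R) - e(N)` does
  have hfin : ∀ s, 0 < s → HasRank R M s → IsUnmixed R R → n * mult I d R - mult I d N ≤ 0 →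
      Module.Free R N := by
    intro s hs hMs hun h
    have hRd := hRdim s hs hMs
    have hFd : Module.supportDim R (Fin n → R) ≤ d := by
      rw [← hRd, Module.supportDim, Module.supportDim, support_self R]
      exact Order.krullDim_le_of_strictMono (fun q => ⟨q.1, Set.mem_univ _⟩) fun _ _ h => h
    refine free_of_forall_notMem_support hπ fun q hq => ?_
    rw [hun] at hq
    refine notMem_support_of_mult_nonpos hI ((Module.supportDim_le_of_injective _
      (Submodule.injective_subtype _)).trans hFd) ?_ (hq.2.trans hRd)
    rwa [mult_ker hI hFd hπ, mult_pi hI hRd.le]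
  refine ⟨?_, ?_⟩
  -- a point of dimension `d` of `Supp T` lies in `Assh M` and in `Supp N`
  · intro r hfree hr
    obtain ⟨p, hp, hpd⟩ := exists_mem_support_ringKrullDim_eq hTd
    rw [hsuppT] at hp
    obtain ⟨f⟩ := nonempty_equiv_of_free hr (hfree p (hAssh p hp.1 hpd))
    have := Module.mem_support_iff.1 hp.2
    by_contra h0
    obtain rfl : r = 0 := by omega
    exact not_subsingleton _ f.toEquiv.subsingleton
  · rintro (⟨⟨r, hr⟩, ⟨p, hp, hTor⟩, hcT⟩ | ⟨hfree, r, hr, hcr⟩ | ⟨hun, hcT, h⟩ |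
      ⟨⟨s, hs, hMs⟩, hun, hcN⟩ | ⟨⟨s, hs, hMs⟩, hun, r, hNr, hcr⟩)
    -- (i): `K` vanishes at `p`, hence at an associated prime of `R` below `p`, which gives `n ≤ r`
    · have hpd : ringKrullDim (R ⧸ p.asIdeal) = d := hp.2.trans hd
      have hpM : p ∈ Module.support R M :=
        Module.mem_support_iff_of_finite.2
          (Submodule.annihilator_top (R := R) (M := M) ▸ IsAssociatedPrime.annihilator_le hp.1)
      have hpK := notMem_support_ker_of_notMem_support_Tor1 hπ hpM
        (Module.notMem_support_iff.2 hTor) (hL hcT p hpd)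
      obtain ⟨q, hq, hqp⟩ := exists_mem_Ass_le p
      exact free_of_forall_hasRank_of_le hπ hr (le_of_notMem_support_ker hπ (hr q hq)
        fun h => hpK (Module.mem_support_mono hqp h))
    -- (ii): `e(T) = r e(M)`, so `n ℓ(M / I M) ≤ r c ℓ(M / I M)`
    · refine free_of_forall_hasRank_of_le hπ hr (le_of_mul_le_of_lt hl ?_ hcr)
      have h1 : mult I d (M ⊗[R] N) = r * mult I d M := mult_tensorProduct hI hd.le
        fun p hp hpd => nonempty_equiv_of_free hr (hfree p (hAssh p hp hpd))
      rw [h1] at hnl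
      push_cast at hnl
      exact hnl.trans (by gcongr)
    -- (iii): `L = 0`, because `Ass L` lies in `Ass M = Assh M`
    · have hL0 := subsingleton_ker_lTensor hd (hL hcT) hun
      have hL0' : ∀ p, p ∉ Module.support R (LinearMap.ker (π.lTensor M)) := fun p =>
        by rw [Module.support_eq_empty]; exact Set.notMem_empty p
      rcases h with h | h | ⟨h, hsupp⟩
      · exact free_of_annihilator_eq_bot hπ hL0 h
      · refine free_of_subsingleton_ker hπ ?_
        by_contra hne
        rw [not_subsingleton_iff_nontrivial] at hne
        refine notMem_support_ker_of_notMem_support_Tor1 hπ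
          (IsLocalRing.closedPoint_mem_support R M) ?_ (hL0' _)
          (IsLocalRing.closedPoint_mem_support R (LinearMap.ker π))
        rw [Module.support_eq_empty]
        exact Set.notMem_empty _
      · exact free_of_forall_notMem_support hπ fun q hq =>
          notMem_support_ker_of_notMem_support_Tor1 hπ (hsupp ▸ Set.mem_univ q)
            (notMem_support_of_isTorsion h hq) (hL0' q)
    -- (iv): `s e(K) = n e(M) - e(T) ≤ (c - 1) s e(N) < s`
    · obtain ⟨hNd, hMR, hTN⟩ := hrank s hs hMs
      rw [hilbertSamuelMult_eq_mult hI hNd] at hcN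
      have hs' : (0 : ℝ) < s := by exact_mod_cast hs
      refine hfin s hs hMs hun ?_
      have h1 := sub_one_mul_lt_one (by exact_mod_cast mult_pos hI hNd) hcN
      have h2 : (s : ℝ) * (n * mult I d R - mult I d N) ≤ s * ((c - 1) * mult I d N) := by
        rw [hMR, hTN] at hnM
        push_cast at hnM
        linarith
      have h3 := (le_of_mul_le_mul_left h2 hs').trans_lt h1
      have h4 : n * mult I d R - mult I d N < 1 := by exact_mod_cast h3
      omega
    -- (v): `e(T) = r e(M)` gives `n ≤ r`, and then `e(K) = (n - r) e(R) ≤ 0`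
    · obtain ⟨hNd, hMR, hTN⟩ := hrank s hs hMs
      have hRd := hRdim s hs hMs
      rw [hilbertSamuelMult_eq_mult hI hNd, hilbertSamuelMult_eq_mult hI hRd] at hNr
      have hNr' : mult I d N = r * mult I d R := by exact_mod_cast hNr
      have hnr : n ≤ r := by
        refine le_of_mul_le_of_lt hl ?_ hcr
        have h1 : mult I d (M ⊗[R] N) = r * mult I d M := by
          rw [hTN, hNr', hMR]
          ring
        rw [h1] at hnl
        push_cast at hnl
        exact hnl.trans (by gcongr)
      refine hfin s hs hMs hun ?_
      rw [hNr', ← sub_mul]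
      have h2 : (n : ℤ) - r ≤ 0 := by omega
      exact mul_nonpos_of_nonpos_of_nonneg h2 (mult_nonneg hI hRd.le)
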